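/- Let $S^1=\mathbb R/\mathbb Z$, let $V\in C^2(S^1\times S^1)$ and let $W\in C^2(S^1)$; regard them as periodic functions $V(t,x)$ and $W(x)$ on $\mathbb R^2$ and $\mathbb R$. Assume that $W$ is even, $W\le 0$, $W(x)=0$ if and only if $x\in\mathbb Z$, and $W''(x)<0$ for $x\in\mathbb Z$. Let $I=[0,1)$ with Lebesgue measure $\nu_0$, let $L^2(I)=L^2(I,\mathbb R)$ and $L^2_{\mathbb Z}=L^2(I,\mathbb Z)$, and let $\mathrm{Group}$ be the group of bijections of $I$ that preserve $\nu_0$ and are measurable together with their inverse. For $c,t\in\mathbb R$ and $M,N\in L^2(I)$ put $$\mathcal L_c(t,M,N)=\tfrac12\|N\|_{L^2(I)}^2-\int_I V(t,Mz)\,dz-\tfrac12\int_{I\times I}W(Mz-Mz')\,dz\,dz'-c\int_I N z\,dz .$$ Let $C_{\mathrm{Group}}(\mathbf T)$ be the set of continuous $U:L^2(I)\to\mathbb R$ such that $U(M+Z)=U(M)$ and $U(M\circ G)=U(M)$ for all $M\in L^2(I)$, $Z\in L^2_{\mathbb Z}$ and $G\in\mathrm{Group}$. Let $AC([0,1],L^2(I))$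 be the set of continuous curves $\sigma:[0,1]\to L^2(I)$ that have a weak derivative $\dot\sigma\in L^1([0,1],L^2(I))$. For $U\in C_{\mathrm{Group}}(\mathbf T)$, $\alpha\in\mathbb R$ and $M\in L^2(I)$ define $$\hat U(M)=\inf\Big\{\int_0^1\mathcal L_c(t,\sigma_t,\dot\sigma_t)\,dt+U(\sigma_1)\ :\ \sigma\in AC([0,1],L^2(I)),\ \sigma_0=M\Big\},\qquad \Lambda_{c,\alpha}U=\hat U+\alpha .$$ Let $\pi:\mathbb R\to S^1$ be the projection, write $M\simeq M'$ if $(\pi\circ M)_\sharp\nu_0=(\pi\circ M')_\sharp\nu_0$, and let $\mathbf S$ be the quotient of $L^2(I)$ by $\simeq$ (equivalently, of $\mathbf T=L^2(I)/L^2_{\mathbb Z}$, since $M+Z\simeq M$ for $Z\in L^2_{\mathbb Z}$), with the distance $$\mathrm{dist}_{\mathbf S}([M],[M'])=\inf\{\|M^*-M'^*\|_{L^2(I)}:\ M^*\in[M],\ M'^*\in[M']\}.$$ **Proposition 2.11.** For every $c\in\mathbb R$ there is a unique constant $\alpha(c)\in\mathbb R$ such that the operator $\Lambda_{c,\alpha(c)}$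 has a fixed point in $C_{\mathrm{Group}}(\mathbf T)$. Moreover, there is a constant $L>0$, depending only on $V$, $W$ and $c$, such that for every $U\in C_{\mathrm{Group}}(\mathbf T)$ the function $\hat U$ is finite and passes to the quotient as an $L$-Lipschitz function on $\mathbf S$ for $\mathrm{dist}_{\mathbf S}$, and, with the same $L$, every fixed point of $\Lambda_{c,\alpha(c)}$ in $C_{\mathrm{Group}}(\mathbf T)$ passes to the quotient as an $L$-Lipschitz function on $\mathbf S$ for $\mathrm{dist}_{\mathbf S}$. -/

import Mathlib

open MeasureTheory

noncomputable section

namespace VlasovLO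

/-- The label space `I = [0,1)`. -/
abbrev UI : Type := Set.Ico (0 : ℝ) 1

/-- Lebesgue measure on `I`. -/
abbrev nu0 : Measure UI := Measure.comap Subtype.val (volume : Measure ℝ)

/-- The Hilbert space `L²(I) = L²(I, ℝ)`. -/
abbrev L2I : Type := Lp ℝ 2 nu0

/-- Membership in `L²_ℤ(I) = L²(I, ℤ)`: integer valued almost everywhere. -/
def IntValued (Z : L2I) : Prop := ∀ᵐ z ∂nu0, ∃ k : ℤ, Z z = (k : ℝ)

/-- The class of continuous functions on `L²(I)` that are invariant under translations by `L²_ℤ(I)`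
and under rearrangements, i.e. under `M ↦ M ∘ G` for every Lebesgue measure preserving bijection `G`
of `I` which is measurable together with its inverse. -/
structure IsCGroup (U : L2I → ℝ) : Prop where
  continuous : Continuous U
  add_intValued : ∀ M Z : L2I, IntValued Z → U (M + Z) = U M
  comp_rearrangement : ∀ (G : UI ≃ᵐ UI) (hG : MeasurePreserving G nu0 nu0) (M : L2I),
    U (Lp.compMeasurePreserving G hG M) = U M

/-! ### The Lagrangian -/

/-- `𝒱(t, M) = ∫_I V(t, M z) dz`. -/
def potV (V : ℝ → ℝ → ℝ) (t : ℝ) (M : L2I) : ℝ := ∫ z, V t (M z) ∂nu0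

/-- `𝒲(M) = ½ ∫_{I×I} W(M z - M z') dz dz'`. -/
def potW (W : ℝ → ℝ) (M : L2I) : ℝ := (1 / 2) * ∫ z, ∫ z', W (M z - M z') ∂nu0 ∂nu0

/-- `ℒ_c(t, M, N) = ½ ‖N‖² - 𝒱(t, M) - 𝒲(M) - ⟨c, N⟩`, the real number `c` being identified with
the corresponding constant function in `L²(I)`. -/
def lagr (V : ℝ → ℝ → ℝ) (W : ℝ → ℝ) (c : ℝ) (t : ℝ) (M N : L2I) : ℝ :=
  (1 / 2) * ‖N‖ ^ 2 - potV V t M - potW W M - c * ∫ z, N z ∂nu0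

/-! ### Absolutely continuous curves and their action -/

/-- `σ ∈ AC([0,1], L²(I))` with derivative `v = σ̇`: `σ` is (the continuous representative of) a curve
whose weak derivative on `(0,1)` is `v ∈ L¹([0,1], L²(I))`. Only the values on `[0,1]` matter. -/
structure IsACWithDeriv (σ v : ℝ → L2I) : Prop where
  continuousOn : ContinuousOn σ (Set.Icc 0 1)
  integrable : IntervalIntegrable v volume 0 1
  weakDeriv : ∀ φ : ℝ → ℝ, ContDiff ℝ 1 φ → HasCompactSupport φ → tsupport φ ⊆ Set.Ioo 0 1 →
    ∫ t in (0 : ℝ)..1, deriv φ t • σ t = -∫ t in (0 : ℝ)..1, φ t • v t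

open Classical in
/-- The action `∫₀¹ ℒ_c(t, σ_t, σ̇_t) dt`, with values in `(-∞, +∞]`. For absolutely continuous `σ` and
bounded potentials the integrand is measurable and bounded below, so that the integral is `+∞`
exactly when the integrand is not integrable. -/
def action (V : ℝ → ℝ → ℝ) (W : ℝ → ℝ) (c : ℝ) (σ v : ℝ → L2I) : EReal :=
  if IntervalIntegrable (fun t => lagr V W c t (σ t) (v t)) volume 0 1 then
    ((∫ t in (0 : ℝ)..1, lagr V W c t (σ t) (v t) : ℝ) : EReal)
  else ⊤

/-! ### The Lax-Oleinik operator -/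

/-- `Û(M)`: the infimum, in the extended reals, of `∫₀¹ ℒ_c(t, σ_t, σ̇_t) dt + U(σ_1)` over the curves
`σ ∈ AC([0,1], L²(I))` with `σ_0 = M`. -/
def hatU (V : ℝ → ℝ → ℝ) (W : ℝ → ℝ) (c : ℝ) (U : L2I → ℝ) (M : L2I) : EReal :=
  sInf {x : EReal | ∃ σ v : ℝ → L2I, IsACWithDeriv σ v ∧ σ 0 = M ∧
    x = action V W c σ v + ((U (σ 1) : ℝ) : EReal)}

/-- The operator `Λ_{c,α} : U ↦ Û + α`. -/
def laxOleinik (V : ℝ → ℝ → ℝ) (W : ℝ → ℝ) (c α : ℝ) (U : L2I → ℝ) (M : L2I) : EReal :=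
  hatU V W c U M + (α : EReal)

/-- `U` is a fixed point of `Λ_{c,α}` (in particular `Û` is finite everywhere). -/
def IsFixedPointLO (V : ℝ → ℝ → ℝ) (W : ℝ → ℝ) (c α : ℝ) (U : L2I → ℝ) : Prop :=
  ∀ M : L2I, laxOleinik V W c α U M = ((U M : ℝ) : EReal)

/-! ### The quotient space `𝐒` and its distance -/

/-- `Φ(M) = (π ∘ M)_♯ ν₀`, the law of `M` on the circle `S¹ = ℝ/ℤ`. -/
def circleLaw (M : L2I) : Measure UnitAddCircle :=
  nu0.map (fun z => ((M z : ℝ) : UnitAddCircle))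

/-- `Φ` is invariant under `L²_ℤ(I)`; hence the quotient of `L²(I)/L²_ℤ(I)` by equality of `Φ` is the
quotient of `L²(I)` by equality of `Φ`. -/
theorem circleLaw_add_intValued (M Z : L2I) (hZ : IntValued Z) :
    circleLaw (M + Z) = circleLaw M := by
  refine Measure.map_congr ?_
  filter_upwards [hZ, Lp.coeFn_add M Z] with z hz hadd
  obtain ⟨k, hk⟩ := hz
  rw [hadd, Pi.add_apply, hk, AddCircle.coe_add]
  have : ((k : ℝ) : UnitAddCircle) = 0 := (AddCircle.coe_eq_zero_iff (1 : ℝ)).2 ⟨k, by simp⟩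
  rw [this, add_zero]

/-- `M ≃ M'` if and only if `Φ(M) = Φ(M')`. -/
def lawSetoid : Setoid L2I := Setoid.ker circleLaw

/-- The quotient space `𝐒`. -/
def SpaceS : Type := Quotient lawSetoid

/-- The projection `M ↦ [M]` of `L²(I)` onto `𝐒`. -/
def toS (M : L2I) : SpaceS := Quotient.mk lawSetoid M

/-- `dist_𝐒(p, q) = inf {‖M - M'‖ : M ∈ p, M' ∈ q}`. -/
def distS (p q : SpaceS) : ℝ :=
  sInf {r : ℝ | ∃ M M' : L2I, toS M = p ∧ toS M' = q ∧ r = ‖M - M'‖}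

/-- `F` passes to the quotient `𝐒`, as an `L`-Lipschitz function for `dist_𝐒`. -/
def DescendsLipschitz (L : ℝ) (F : L2I → ℝ) : Prop :=
  ∃ u : SpaceS → ℝ, (∀ M : L2I, u (toS M) = F M) ∧
    ∀ p q : SpaceS, |u p - u q| ≤ L * distS p q

end VlasovLO

end

namespace VlasovLO

/-! ### Interval exchanges of `I` -/

/-! Let T be the operator `U ↦ Û`, written `realHat` once the infimum is known to be finite. Two
compactness facts make it tractable.

First, a function of the class `C_Group` depends only on the law on the circle, and the space of
laws is sequentially compact. If two laws give nearly equal masses to the arcs of a fine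
subdivision, an interval exchange carries one fractional part close to the other in L²
(`exists_rearr_near`). Hence functions of the class descend to the quotient, are bounded below
(`IsCGroup.bddBelow`) and satisfy Dini's theorem (`exists_uniform_of_monotone`).

Second, T regularises uniformly in `U`. Since the endpoint of a curve can be moved by an
integer-valued function at no cost in `U`, a nearly optimal curve competes with a segment of length
at most 1, and so has bounded kinetic energy. Shifting its starting point while keeping its endpoint
then costs at most `lipConst` times the shift (`RegularPotentials.realHat_lipschitz`). Every `Û`
therefore has the same Lipschitz constant and an oscillation bounded by it.

T is monotone and commutes with the addition of constants, so n ↦ Tⁿ0 is quasi-additive up to that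
oscillation, and Tⁿ0 - n·l stays bounded for some rate l. The liminf of these functions satisfies T
U = U + l: infima commute with T because T is itself an infimum, and the remaining increasing limit
is uniform by Dini. Thus α = -l works. Uniqueness follows by comparing suprema of differences of
fixed points. -/

theorem nu0_apply (s : Set UI) : nu0 s = volume (Subtype.val '' s) :=
  comap_subtype_coe_apply measurableSet_Ico _ _

instance : IsProbabilityMeasure nu0 :=
  ⟨by rw [nu0_apply, Set.image_univ, Subtype.range_coe, Real.volume_Ico]; simp⟩

/-- The index of the interval `[k/N, (k+1)/N)` that contains `z`. -/
noncomputable def cell (N : ℕ) [NeZero N] (z : UI) : Fin N :=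
  ⟨⌊N * (z : ℝ)⌋₊, by
    have hN : (0 : ℝ) < N := Nat.cast_pos.2 (NeZero.pos N)
    rw [Nat.floor_lt (mul_nonneg hN.le z.2.1)]
    nlinarith [z.2.2]⟩

variable {N : ℕ} [NeZero N]

theorem cell_eq_iff (z : UI) (k : Fin N) :
    cell N z = k ↔ (k : ℝ) ≤ N * (z : ℝ) ∧ N * (z : ℝ) < k + 1 := by
  have hN : (0 : ℝ) < N := Nat.cast_pos.2 (NeZero.pos N)
  rw [Fin.ext_iff]
  exact Nat.floor_eq_iff (mul_nonneg hN.le z.2.1)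

theorem cell_spec (z : UI) :
    ((cell N z : ℕ) : ℝ) ≤ N * (z : ℝ) ∧ N * (z : ℝ) < (cell N z : ℕ) + 1 :=
  (cell_eq_iff z _).1 rfl

theorem measurable_cell : Measurable (cell N) := by
  refine measurable_to_countable' fun k => ?_
  have : cell N ⁻¹' {k} = (fun z : UI => N * (z : ℝ)) ⁻¹' Set.Ico (k : ℝ) (k + 1) := by
    ext z
    simp [cell_eq_iff]
  rw [this]
  exact (measurable_subtype_coe.const_mul _) measurableSet_Ico

theorem image_cell_preimage (k : Fin N) :
    (Subtype.val '' (cell N ⁻¹' {k}) : Set ℝ) = Set.Ico ((k : ℝ) / N) ((k + 1) / N) := by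
  have hN : (0 : ℝ) < N := Nat.cast_pos.2 (NeZero.pos N)
  ext x
  constructor
  · rintro ⟨z, hz, rfl⟩
    have h := (cell_eq_iff z k).1 hz
    exact ⟨(div_le_iff₀' hN).2 h.1, (lt_div_iff₀' hN).2 h.2⟩
  · rintro ⟨h1, h2⟩
    rw [div_le_iff₀' hN] at h1
    rw [lt_div_iff₀' hN] at h2
    have hk : (k : ℝ) + 1 ≤ N := by exact_mod_cast k.2
    have hk0 : (0 : ℝ) ≤ k := by positivity
    refine ⟨⟨x, ?_, ?_⟩, (cell_eq_iff _ _).2 ⟨h1, h2⟩, rfl⟩ <;> by_contra! h <;> nlinarith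

theorem nu0_cell_preimage (k : Fin N) : nu0.real (cell N ⁻¹' {k}) = 1 / N := by
  have hN : (0 : ℝ) < N := Nat.cast_pos.2 (NeZero.pos N)
  rw [Measure.real, nu0_apply, image_cell_preimage, Real.volume_Ico, ENNReal.toReal_ofReal]
  · ring
  · rw [← sub_div]; simp

theorem nu0_cell_preimage_finset (S : Finset (Fin N)) :
    nu0.real (cell N ⁻¹' (S : Set (Fin N))) = S.card / N := by
  have h := sum_measureReal_preimage_singleton (μ := nu0) S (f := cell N)
    (fun y _ => measurable_cell (measurableSet_singleton y))
  rw [← h]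
  simp [nu0_cell_preimage, div_eq_mul_inv]

/-- The exchange of the intervals `[k/N, (k+1)/N)` according to a permutation of their indices. -/
noncomputable def exch (s : Equiv.Perm (Fin N)) (z : UI) : UI :=
  ⟨z + ((s (cell N z) : ℝ) - (cell N z : ℕ)) / N, by
    have hN : (0 : ℝ) < N := Nat.cast_pos.2 (NeZero.pos N)
    obtain ⟨h1, h2⟩ := cell_spec (N := N) z
    have hk : ((s (cell N z) : ℕ) : ℝ) + 1 ≤ N := by exact_mod_cast (s (cell N z)).2
    have hk0 : (0 : ℝ) ≤ (s (cell N z) : ℕ) := by positivity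
    have e : (z : ℝ) + ((s (cell N z) : ℝ) - (cell N z : ℕ)) / N
      = (N * (z : ℝ) + ((s (cell N z) : ℝ) - (cell N z : ℕ))) / N := by field_simp
    rw [e]
    constructor
    · apply div_nonneg _ hN.le; linarith
    · rw [div_lt_one hN]; linarith⟩

theorem exch_val (s : Equiv.Perm (Fin N)) (z : UI) :
    (exch s z : ℝ) = z + ((s (cell N z) : ℝ) - (cell N z : ℕ)) / N := rfl

theorem cell_exch (s : Equiv.Perm (Fin N)) (z : UI) : cell N (exch s z) = s (cell N z) := by
  have hN : (0 : ℝ) < N := Nat.cast_pos.2 (NeZero.pos N)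
  obtain ⟨h1, h2⟩ := cell_spec (N := N) z
  have e : (N : ℝ) * (exch s z : ℝ) = N * (z : ℝ) + ((s (cell N z) : ℝ) - (cell N z : ℕ)) := by
    rw [exch_val]; field_simp
  rw [cell_eq_iff, e]
  constructor <;> linarith

theorem exch_symm_exch (s : Equiv.Perm (Fin N)) (z : UI) : exch s.symm (exch s z) = z := by
  ext
  rw [exch_val, cell_exch, exch_val, Equiv.symm_apply_apply]
  ring

theorem measurable_exch (s : Equiv.Perm (Fin N)) : Measurable (exch s) := by
  refine Measurable.subtype_mk ?_
  refine measurable_subtype_coe.add ?_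
  exact (measurable_of_finite (fun k : Fin N => ((s k : ℝ) - (k : ℕ)) / N)).comp measurable_cell

/-- `exch s` as a measurable equivalence. -/
noncomputable def exchEquiv (s : Equiv.Perm (Fin N)) : UI ≃ᵐ UI where
  toFun := exch s
  invFun := exch s.symm
  left_inv := exch_symm_exch s
  right_inv z := by simpa using exch_symm_exch s.symm z
  measurable_toFun := measurable_exch s
  measurable_invFun := measurable_exch s.symm

theorem nu0_eq_sum_cells (A : Set UI) :
    nu0 A = ∑ k : Fin N, nu0 (cell N ⁻¹' {k} ∩ A) := by
  have h := sum_measure_preimage_singleton (μ := nu0.restrict A) Finset.univ (f := cell N)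
    (fun y _ => measurable_cell (measurableSet_singleton y))
  simp only [Finset.coe_univ, Set.preimage_univ, Measure.restrict_apply_univ] at h
  rw [← h]
  exact Finset.sum_congr rfl fun k _ =>
    Measure.restrict_apply (measurable_cell (measurableSet_singleton k))

/-- On each cell the exchange is a translation onto another cell, so invariance of Lebesgue measure,
summed over the cells and reindexed by `s`, suffices. -/
theorem measurePreserving_exchEquiv (s : Equiv.Perm (Fin N)) :
    MeasurePreserving (exchEquiv s) nu0 nu0 := by
  refine ⟨(exchEquiv s).measurable, Measure.ext fun A hA => ?_⟩
  rw [Measure.map_apply (exchEquiv s).measurable hA, nu0_eq_sum_cells (N := N),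
    nu0_eq_sum_cells (N := N) A,
    ← Equiv.sum_comp s (fun k => nu0 (cell N ⁻¹' {k} ∩ A))]
  refine Finset.sum_congr rfl fun k _ => ?_
  rw [nu0_apply, nu0_apply]
  have : (Subtype.val '' (cell N ⁻¹' {k} ∩ exchEquiv s ⁻¹' A) : Set ℝ)
      = (fun x => x + ((s k : ℝ) - (k : ℕ)) / N) ⁻¹'
        (Subtype.val '' (cell N ⁻¹' {s k} ∩ A)) := by
    ext x
    constructor
    · rintro ⟨z, ⟨hz, hzA⟩, rfl⟩
      simp only [Set.mem_preimage, Set.mem_singleton_iff] at hz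
      refine ⟨exch s z, ⟨?_, hzA⟩, ?_⟩
      · simp [cell_exch, hz]
      · rw [exch_val, hz]
    · rintro ⟨w, ⟨hw, hwA⟩, hx⟩
      simp only [Set.mem_preimage, Set.mem_singleton_iff] at hw
      refine ⟨exch s.symm w, ⟨?_, ?_⟩, ?_⟩
      · simp [cell_exch, hw]
      · change exch s (exch s.symm w) ∈ A
        have := exch_symm_exch s.symm w
        rw [Equiv.symm_symm] at this
        rwa [this]
      · rw [exch_val, hw, Equiv.symm_apply_apply, hx]
        ring
  rw [this, measure_preimage_add_right]

/-! ### Approximation by functions that are constant on cells -/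

/-- Approximate the integer-valued `f` in L¹ by a uniformly continuous `g`. Where the two are close,
rounding `g` at the left end of a fine cell recovers `f`, and Markov's inequality bounds the rest.
-/
theorem exists_cell_approx {n : ℕ} (f : UI → Fin n) (hf : Measurable f) {δ : ℝ} (hδ : 0 < δ) :
    ∃ N₀ : ℕ, ∀ (N : ℕ) [NeZero N], N₀ ≤ N →
      ∃ a : Fin N → Fin n, nu0.real {z | f z ≠ a (cell N z)} ≤ δ := by
  let e : UI → ℝ := Subtype.val
  have he : MeasurableEmbedding e := MeasurableEmbedding.subtype_coe measurableSet_Ico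
  let μ : Measure ℝ := nu0.map e
  have : IsProbabilityMeasure μ := Measure.isProbabilityMeasure_map he.measurable.aemeasurable
  have hfr : Measurable (fun z => ((f z : ℕ) : ℝ)) :=
    (measurable_of_finite (fun k : Fin n => ((k : ℕ) : ℝ))).comp hf
  let F : ℝ → ℝ := Function.extend e (fun z => ((f z : ℕ) : ℝ)) 0
  have hFe : ∀ z, F (e z) = (f z : ℕ) := fun z => he.injective.extend_apply _ _ z
  have hFm : Measurable F := he.measurable_extend hfr measurable_const
  have hFi : Integrable F μ := by
    rw [he.integrable_map_iff]
    refine Integrable.of_bound (hFm.comp he.measurable).aestronglyMeasurable (n : ℝ) ?_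
    refine Filter.Eventually.of_forall fun z => ?_
    simp only [Function.comp, hFe]
    rw [Real.norm_of_nonneg (by positivity)]
    exact_mod_cast (f z).2.le
  -- An L¹ error of δ/4 and the Markov threshold 1/4 leave an exceptional set of measure at most δ.
  obtain ⟨g, hgc, hgF, hg, hgi⟩ := hFi.exists_hasCompactSupport_integral_sub_le
    (ε := δ / 4) (by positivity)
  have hu := Metric.uniformContinuous_iff.1 (hgc.uniformContinuous_of_continuous hg) (1 / 4)
    (by norm_num)
  obtain ⟨η, hη, hu⟩ := hu
  obtain ⟨N₀, hN₀⟩ := exists_nat_gt (1 / η)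
  refine ⟨N₀, fun N _ hN => ?_⟩
  have hNp : (0 : ℝ) < N := Nat.cast_pos.2 (NeZero.pos N)
  have hNη : 1 / (N : ℝ) < η := by
    rw [div_lt_comm₀ hNp hη]
    exact hN₀.trans_le (by exact_mod_cast hN)
  classical
  let j₀ : Fin n := f ⟨0, by simp⟩
  -- Two integers within 1/2 of the same value of `g` coincide, so any choice is the right one; `j₀`
  -- is a dummy for cells where no label is that close.
  let a : Fin N → Fin n := fun k =>
    if h : ∃ j : Fin n, |((j : ℕ) : ℝ) - g ((k : ℝ) / N)| < 1 / 2 then h.choose else j₀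
  have key : ∀ z : UI, |F (e z) - g (e z)| < 1 / 4 → f z = a (cell N z) := by
    intro z hz
    obtain ⟨h1, h2⟩ := cell_spec (N := N) z
    have hd : dist (e z) (((cell N z : ℕ) : ℝ) / N) < η := by
      refine lt_of_le_of_lt ?_ hNη
      have : (z : ℝ) = (N * (z : ℝ)) / N := by field_simp
      rw [Real.dist_eq]
      change |(z : ℝ) - _| ≤ _
      rw [this, ← sub_div, abs_div, abs_of_pos hNp]
      gcongr
      rw [abs_le]; constructor <;> linarith
    have h3 := hu hd
    rw [Real.dist_eq] at h3
    rw [hFe] at hz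
    have h4 : |((f z : ℕ) : ℝ) - g (((cell N z : ℕ) : ℝ) / N)| < 1 / 2 := by
      have := abs_sub_le ((f z : ℕ) : ℝ) (g (e z)) (g (((cell N z : ℕ) : ℝ) / N))
      linarith
    have hex : ∃ j : Fin n, |((j : ℕ) : ℝ) - g (((cell N z : ℕ) : ℝ) / N)| < 1 / 2 := ⟨f z, h4⟩
    have ha : a (cell N z) = hex.choose := dif_pos hex
    have h5 := hex.choose_spec
    rw [← ha] at h5
    have h6 : |((f z : ℕ) : ℝ) - ((a (cell N z) : ℕ) : ℝ)| < 1 := by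
      have := abs_sub_le ((f z : ℕ) : ℝ) (g (((cell N z : ℕ) : ℝ) / N)) ((a (cell N z) : ℕ) : ℝ)
      rw [abs_sub_comm (g _) _] at this
      linarith
    rw [abs_lt] at h6
    have h7 : ((f z : ℕ) : ℝ) < (a (cell N z) : ℕ) + 1 := by linarith
    have h8 : ((a (cell N z) : ℕ) : ℝ) < (f z : ℕ) + 1 := by linarith
    norm_cast at h7 h8
    ext; omega
  refine ⟨a, ?_⟩
  have hint : Integrable (fun x => ‖F x - g x‖) μ := (hFi.sub hgi).norm
  have hm := mul_meas_ge_le_integral_of_nonneg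
    (Filter.Eventually.of_forall fun x => norm_nonneg (F x - g x)) hint (1 / 4)
  have hsub : nu0.real {z | f z ≠ a (cell N z)} ≤ μ.real {x | 1 / 4 ≤ ‖F x - g x‖} := by
    have : μ.real {x | 1 / 4 ≤ ‖F x - g x‖} = nu0.real (e ⁻¹' {x | 1 / 4 ≤ ‖F x - g x‖}) := by
      rw [Measure.real, he.map_apply, ← Measure.real]
    rw [this]
    refine measureReal_mono fun z hz => ?_
    by_contra h
    simp only [Set.mem_preimage, Set.mem_ofPred_eq, not_le] at h
    exact hz (key z h)
  linarith

/-! ### Matching two colourings of a finite set -/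

/-- Take a permutation with the fewest mismatches. No colour can be taken by `a ∘ s` at one mismatch
and by `b` at another, as a swap would repair one of them. So on the mismatch set each colour is
used by only one of the two, and the sum on the right is exactly twice the number of mismatches. -/
theorem exists_perm_matching {ι κ : Type*} [Fintype ι] [DecidableEq ι] [Fintype κ] [DecidableEq κ]
    (a b : ι → κ) : ∃ s : Equiv.Perm ι,
      (2 * (Finset.univ.filter fun i => a (s i) ≠ b i).card : ℝ) ≤
        ∑ k, |((Finset.univ.filter fun i => a i = k).card : ℝ)
          - (Finset.univ.filter fun i => b i = k).card| := by
  obtain ⟨s, hs⟩ := Finite.exists_min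
    (fun s : Equiv.Perm ι => (Finset.univ.filter fun i => a (s i) ≠ b i).card)
  refine ⟨s, ?_⟩
  set D := Finset.univ.filter fun i => a (s i) ≠ b i with hD
  have disj : ∀ i ∈ D, ∀ j ∈ D, a (s i) ≠ b j := by
    intro i hi j hj hij
    have hne : i ≠ j := by
      rintro rfl
      exact (Finset.mem_filter.1 hi).2 hij
    refine absurd (hs ((Equiv.swap i j).trans s)) (not_le.2 ?_)
    refine Finset.card_lt_card ⟨fun k hk => ?_, fun h => ?_⟩
    · rw [Finset.mem_filter] at hk ⊢
      refine ⟨Finset.mem_univ _, ?_⟩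
      by_cases hki : k = i
      · subst hki; exact (Finset.mem_filter.1 hi).2
      by_cases hkj : k = j
      · subst hkj; exact (Finset.mem_filter.1 hj).2
      simpa [Equiv.swap_apply_of_ne_of_ne hki hkj] using hk.2
    · have := (Finset.mem_filter.1 (h hj)).2
      simp [hij] at this
  have hk : ∀ k, |((Finset.univ.filter fun i => a i = k).card : ℝ)
      - (Finset.univ.filter fun i => b i = k).card|
      = ((D.filter fun i => a (s i) = k).card : ℝ) + (D.filter fun i => b i = k).card := by
    intro k
    have h1 : (Finset.univ.filter fun i => a i = k).card
        = (Finset.univ.filter fun i => a (s i) = k).card := by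
      refine (Finset.card_equiv s fun i => ?_).symm
      simp
    have split : ∀ c : ι → κ, ((Finset.univ.filter fun i => c i = k).card : ℝ)
        = (D.filter fun i => c i = k).card + (Dᶜ.filter fun i => c i = k).card := by
      intro c
      rw [← Nat.cast_add, ← Finset.card_union_of_disjoint, ← Finset.filter_union,
        Finset.union_compl]
      exact Finset.disjoint_filter_filter disjoint_compl_right
    have h2 : (Dᶜ.filter fun i => a (s i) = k) = Dᶜ.filter fun i => b i = k := by
      refine Finset.filter_congr fun i hi => ?_
      have : a (s i) = b i := by simpa [hD] using hi
      rw [this]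
    rw [h1, split (fun i => a (s i)), split b, h2, add_sub_add_right_eq_sub]
    by_cases h : (D.filter fun i => a (s i) = k) = ∅
    · simp [h]
    · have h' : (D.filter fun i => b i = k) = ∅ := by
        obtain ⟨i, hi⟩ := Finset.nonempty_iff_ne_empty.2 h
        rw [Finset.mem_filter] at hi
        refine Finset.filter_eq_empty_iff.2 fun j hj hjk => ?_
        exact disj i hi.1 j hj (hi.2.trans hjk.symm)
      simp [h']
  rw [Finset.sum_congr rfl fun k _ => hk k, Finset.sum_add_distrib, ← Nat.cast_sum, ← Nat.cast_sum,
    ← Finset.card_eq_sum_card_fiberwise (fun _ _ => Finset.mem_coe.2 (Finset.mem_univ _)),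
    ← Finset.card_eq_sum_card_fiberwise (fun _ _ => Finset.mem_coe.2 (Finset.mem_univ _))]
  linarith

/-- If the fibres of two measurable functions with values in a finite set have almost the same
measures, then the functions almost agree up to an interval exchange. -/
theorem exists_rearrangement_fin {n : ℕ} (f g : UI → Fin n) (hf : Measurable f)
    (hg : Measurable g) {δ : ℝ} (hδ : 0 < δ)
    (hfg : ∀ k, |nu0.real (f ⁻¹' {k}) - nu0.real (g ⁻¹' {k})| ≤ δ) :
    ∃ G : UI ≃ᵐ UI, MeasurePreserving G nu0 nu0 ∧
      nu0.real {z | f (G z) ≠ g z} ≤ (2 + 3 * n) * δ := by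
  obtain ⟨N₁, h₁⟩ := exists_cell_approx f hf hδ
  obtain ⟨N₂, h₂⟩ := exists_cell_approx g hg hδ
  -- The `+ 1` makes the number of cells nonzero.
  let N := max N₁ N₂ + 1
  have hNp : (0 : ℝ) < N := by positivity
  obtain ⟨a, ha⟩ := h₁ N (by omega)
  obtain ⟨b, hb⟩ := h₂ N (by omega)
  have count : ∀ (h : UI → Fin n) (c : Fin N → Fin n), nu0.real {z | h z ≠ c (cell N z)} ≤ δ →
      ∀ k, |nu0.real (h ⁻¹' {k}) - (Finset.univ.filter fun i => c i = k).card / N| ≤ δ := by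
    intro h c hc k
    rw [← nu0_cell_preimage_finset]
    rw [abs_sub_le_iff, sub_le_iff_le_add, sub_le_iff_le_add]
    constructor
    · refine le_trans (measureReal_mono fun z hz => ?_) ((measureReal_union_le _ _).trans
        (add_le_add_left hc _))
      by_cases hh : h z = c (cell N z)
      · right
        simp only [Set.mem_preimage, Set.mem_singleton_iff] at hz
        simp [← hh, hz]
      · left; exact hh
    · refine le_trans (measureReal_mono fun z hz => ?_) ((measureReal_union_le _ _).trans
        (add_le_add_left hc _))
      by_cases hh : h z = c (cell N z)
      · right
        have : c (cell N z) = k := by simpa using hz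
        simp [hh, this]
      · left; exact hh
  obtain ⟨s, hs⟩ := exists_perm_matching a b
  have hcard : ∀ k, |((Finset.univ.filter fun i => a i = k).card : ℝ)
          - (Finset.univ.filter fun i => b i = k).card| ≤ 3 * δ * N := by
    intro k
    have h1 := abs_le.1 (count f a ha k)
    have h2 := abs_le.1 (count g b hb k)
    have h3 := abs_le.1 (hfg k)
    have : |((Finset.univ.filter fun i => a i = k).card : ℝ) / N
          - (Finset.univ.filter fun i => b i = k).card / N| ≤ 3 * δ := by
      rw [abs_le]; constructor <;> linarith
    rw [← sub_div, abs_div, abs_of_pos hNp, div_le_iff₀ hNp] at this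
    exact this
  have hsum := hs.trans (Finset.sum_le_sum fun k _ => hcard k)
  simp only [Finset.sum_const, Finset.card_univ, Fintype.card_fin, nsmul_eq_mul] at hsum
  refine ⟨exchEquiv s, measurePreserving_exchEquiv s, ?_⟩
  let D := Finset.univ.filter fun i => a (s i) ≠ b i
  have hDm : nu0.real (cell N ⁻¹' (D : Set (Fin N))) ≤ 3 * n * δ := by
    rw [nu0_cell_preimage_finset, div_le_iff₀ hNp]
    have : (0 : ℝ) ≤ D.card := by positivity
    nlinarith [hsum]
  have hfa : nu0.real (exchEquiv s ⁻¹' {z | f z ≠ a (cell N z)}) ≤ δ := by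
    rw [Measure.real, (measurePreserving_exchEquiv s).measure_preimage_equiv]
    exact ha
  -- The three sources of error cost δ for `f`, 3nδ for the mismatched cells and δ for `g`.
  have hsub : {z | f (exchEquiv s z) ≠ g z} ⊆ (exchEquiv s ⁻¹' {z | f z ≠ a (cell N z)} ∪
      cell N ⁻¹' (D : Set (Fin N))) ∪ {z | g z ≠ b (cell N z)} := by
    intro z hz
    by_contra hcon
    simp only [Set.mem_union, Set.mem_preimage, Set.mem_ofPred_eq, not_or, not_not] at hcon
    obtain ⟨⟨h1, h2⟩, h3⟩ := hcon
    have h4 : cell N (exchEquiv s z) = s (cell N z) := cell_exch s z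
    rw [h4] at h1
    have h5 : a (s (cell N z)) = b (cell N z) := by simpa [D] using h2
    exact hz (by rw [h1, h5, h3])
  have := (measureReal_mono (μ := nu0) hsub).trans ((measureReal_union_le _ _).trans
    (add_le_add_left (measureReal_union_le _ _) _))
  linarith

end VlasovLO

namespace VlasovLO

/-! ### Representatives with values in `[0,1)` -/

/-- The representative in `[0,1)` of a point of the circle. -/
noncomputable def toUI (θ : UnitAddCircle) : UI :=
  ⟨(AddCircle.equivIco 1 0 θ : ℝ), by simpa using (AddCircle.equivIco 1 0 θ).2⟩

theorem measurable_toUI : Measurable toUI :=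
  Measurable.subtype_mk
    (measurable_subtype_coe.comp (AddCircle.measurableEquivIco 1 0).measurable)

theorem toUI_coe (x : ℝ) : (toUI (x : UnitAddCircle) : ℝ) = Int.fract x := by
  simp [toUI, AddCircle.coe_equivIco_mk_apply]

theorem measurable_coe_circle (M : L2I) : Measurable fun z => ((M z : ℝ) : UnitAddCircle) :=
  AddCircle.measurable_mk'.comp (Lp.stronglyMeasurable M).measurable

theorem memLp_fract (M : L2I) : MemLp (fun z => Int.fract (M z)) 2 nu0 := by
  refine MemLp.of_bound
    (measurable_fract.comp (Lp.stronglyMeasurable M).measurable).aestronglyMeasurable 1 (Filter.Eventually.of_forall fun z => ?_)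
  rw [Real.norm_of_nonneg (Int.fract_nonneg _)]
  exact (Int.fract_lt_one _).le

/-- The fractional part of an element of `L²(I)`. -/
noncomputable def fracLp (M : L2I) : L2I := (memLp_fract M).toLp _

theorem coeFn_fracLp (M : L2I) : fracLp M =ᵐ[nu0] fun z => Int.fract (M z) :=
  (memLp_fract M).coeFn_toLp

theorem intValued_fracLp_sub (M : L2I) : IntValued (fracLp M - M) := by
  filter_upwards [coeFn_fracLp M, Lp.coeFn_sub (fracLp M) M] with z h1 h2
  refine ⟨-⌊M z⌋, ?_⟩
  rw [h2, Pi.sub_apply, h1, Int.fract]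
  push_cast
  ring

theorem IntValued.neg {Z : L2I} (hZ : IntValued Z) : IntValued (-Z) := by
  filter_upwards [hZ, Lp.coeFn_neg Z] with z ⟨k, hk⟩ h2
  exact ⟨-k, by rw [h2, Pi.neg_apply, hk]; push_cast; ring⟩

theorem norm_le_of_ae_le {f : L2I} {C : ℝ} (hC : 0 ≤ C) (h : ∀ᵐ z ∂nu0, |f z| ≤ C) : ‖f‖ ≤ C := by
  have := Lp.norm_le_of_ae_bound (f := f) hC h
  simpa [measureUnivNNReal] using this

theorem norm_sq_eq_integral (f : L2I) : ‖f‖ ^ 2 = ∫ z, f z ^ 2 ∂nu0 := by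
  rw [← real_inner_self_eq_norm_sq, L2.inner_def]
  refine integral_congr_ae (Filter.Eventually.of_forall fun z => ?_)
  simp [sq]

theorem norm_sq_le_of_small_off (f : L2I) {A : Set UI} (hA : MeasurableSet A) {η : ℝ}
    (h1 : ∀ᵐ z ∂nu0, |f z| ≤ 1) (h2 : ∀ᵐ z ∂nu0, z ∉ A → |f z| ≤ η) :
    ‖f‖ ^ 2 ≤ η ^ 2 + nu0.real A := by
  rw [norm_sq_eq_integral]
  have hi : Integrable (A.indicator fun _ => (1 : ℝ)) nu0 :=
    (integrable_const _).indicator hA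
  have : η ^ 2 + nu0.real A = ∫ z, (η ^ 2 + A.indicator (fun _ => (1 : ℝ)) z) ∂nu0 := by
    rw [integral_add (integrable_const _) hi, integral_indicator hA]
    simp
  rw [this]
  refine integral_mono_ae (Lp.memLp f).integrable_sq ((integrable_const _).add hi) ?_
  filter_upwards [h1, h2] with z h1 h2
  by_cases hz : z ∈ A
  · simp only [hz, Set.indicator_of_mem]
    have : f z ^ 2 ≤ 1 := by rw [← sq_abs]; exact pow_le_one₀ (abs_nonneg _) h1
    nlinarith [sq_nonneg η]
  · simp only [hz, not_false_eq_true, Set.indicator_of_notMem, add_zero]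
    rw [← sq_abs]
    exact pow_le_pow_left₀ (abs_nonneg _) (h2 hz) 2

/-! ### Laws on the circle -/

theorem circleLaw_comp (G : UI ≃ᵐ UI) (hG : MeasurePreserving G nu0 nu0) (M : L2I) :
    circleLaw (Lp.compMeasurePreserving G hG M) = circleLaw M := by
  have h1 : circleLaw (Lp.compMeasurePreserving G hG M)
      = nu0.map ((fun z => ((M z : ℝ) : UnitAddCircle)) ∘ G) := by
    refine Measure.map_congr ?_
    filter_upwards [Lp.coeFn_compMeasurePreserving M hG] with z hz
    rw [hz]; rfl
  rw [h1, ← Measure.map_map (measurable_coe_circle M) G.measurable, hG.map_eq]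
  rfl

instance (M : L2I) : IsProbabilityMeasure (circleLaw M) :=
  Measure.isProbabilityMeasure_map (measurable_coe_circle M).aemeasurable

/-- The mass that the law of `M` gives to the arc `[k/n, (k+1)/n)`. -/
noncomputable def arcMass (n : ℕ) [NeZero n] (M : L2I) (k : Fin n) : ℝ :=
  (circleLaw M).real ((cell n ∘ toUI) ⁻¹' {k})

theorem arcMass_eq {n : ℕ} [NeZero n] (M : L2I) (k : Fin n) :
    arcMass n M k = nu0.real ((fun z => cell n (toUI (M z : UnitAddCircle))) ⁻¹' {k}) := by
  rw [arcMass, circleLaw, map_measureReal_apply (measurable_coe_circle M)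
    ((measurable_cell.comp measurable_toUI) (measurableSet_singleton k))]
  rfl

theorem arcMass_mem {n : ℕ} [NeZero n] (M : L2I) (k : Fin n) : arcMass n M k ∈ Set.Icc (0 : ℝ) 1 :=
  ⟨measureReal_nonneg, measureReal_le_one⟩

theorem abs_sub_le_of_cell_eq {n : ℕ} [NeZero n] {x y : UI} (h : cell n x = cell n y) :
    |(x : ℝ) - y| ≤ 1 / n := by
  have hn : (0 : ℝ) < n := Nat.cast_pos.2 (NeZero.pos n)
  have h1 := cell_spec (N := n) x
  have h2 := cell_spec (N := n) y
  rw [h] at h1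
  rw [abs_le, neg_le, le_div_iff₀ hn, le_div_iff₀ hn]
  constructor <;> nlinarith

/-- `N` has the same law as `M`, and no function of the class `C_Group` separates them. -/
def Rearr (M N : L2I) : Prop :=
  circleLaw N = circleLaw M ∧ ∀ U : L2I → ℝ, IsCGroup U → U N = U M

/-- Label each point by the arc containing its value on the circle. If the arc masses nearly agree,
a rearrangement makes the labels agree off a small set. There the fractional parts differ by at most
the arc length; elsewhere they differ by at most 1. Since `M'` is an arbitrary representative, the
lemma can be iterated. -/
theorem exists_rearr_near {ε : ℝ} (hε : 0 < ε) : ∃ n : ℕ, ∃ δ > 0, ∀ M M' : L2I,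
    (∀ k : Fin (n + 1), |arcMass (n + 1) M k - arcMass (n + 1) M' k| ≤ δ) →
      ∃ N : L2I, Rearr M N ∧ ‖N - M'‖ ≤ ε := by
  obtain ⟨n, hn⟩ := exists_nat_one_div_lt (half_pos hε)
  have hC : (0 : ℝ) < 2 + 3 * (n + 1 : ℕ) := by positivity
  -- This δ makes the bad set have measure at most (ε/2)²; the arc length is also below ε/2, so the
  -- squared norm is at most ε²/2.
  refine ⟨n, (ε / 2) ^ 2 / (2 + 3 * (n + 1 : ℕ)), by positivity, fun M M' h => ?_⟩
  set δ := (ε / 2) ^ 2 / (2 + 3 * (n + 1 : ℕ))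
  let f : UI → Fin (n + 1) := fun z => cell (n + 1) (toUI (M z : UnitAddCircle))
  let g : UI → Fin (n + 1) := fun z => cell (n + 1) (toUI (M' z : UnitAddCircle))
  have hf : Measurable f := measurable_cell.comp (measurable_toUI.comp (measurable_coe_circle M))
  have hg : Measurable g := measurable_cell.comp (measurable_toUI.comp (measurable_coe_circle M'))
  obtain ⟨G, hG, hGm⟩ := exists_rearrangement_fin f g hf hg (δ := δ) (by positivity) fun k => by
    simpa only [arcMass_eq] using h k
  -- Rearrange the fractional part of `M`, then restore the integer part of `M'`, so that only
  -- fractional parts are compared.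
  let N := Lp.compMeasurePreserving G hG (fracLp M) + -(fracLp M' - M')
  have hM' := (intValued_fracLp_sub M').neg
  have hM := intValued_fracLp_sub M
  have hfr : fracLp M = M + (fracLp M - M) := by abel
  refine ⟨N, ⟨?_, fun U hU => ?_⟩, ?_⟩
  · rw [circleLaw_add_intValued _ _ hM', circleLaw_comp, hfr, circleLaw_add_intValued _ _ hM]
  · rw [hU.add_intValued _ _ hM', hU.comp_rearrangement, hfr, hU.add_intValued _ _ hM]
  have hN : N - M' = Lp.compMeasurePreserving G hG (fracLp M) - fracLp M' := by
    simp only [N]; abel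
  rw [hN]
  have hpt : ∀ᵐ z ∂nu0, (Lp.compMeasurePreserving G hG (fracLp M) - fracLp M' : L2I) z
      = (toUI (M (G z) : UnitAddCircle) : ℝ) - toUI (M' z : UnitAddCircle) := by
    filter_upwards [Lp.coeFn_sub (Lp.compMeasurePreserving G hG (fracLp M)) (fracLp M'),
      Lp.coeFn_compMeasurePreserving (fracLp M) hG, coeFn_fracLp M',
      hG.quasiMeasurePreserving.ae_eq_comp (coeFn_fracLp M)] with z h1 h2 h3 h4
    rw [h1, Pi.sub_apply, h2, h3, h4, toUI_coe, toUI_coe]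
    rfl
  have hA : MeasurableSet {z | f (G z) ≠ g z} :=
    (measurableSet_eq_fun (hf.comp G.measurable) hg).compl
  have := norm_sq_le_of_small_off
    (Lp.compMeasurePreserving G hG (fracLp M) - fracLp M') hA (η := 1 / (n + 1 : ℕ))
    (by
      filter_upwards [hpt] with z hz
      rw [hz, abs_le]
      have h1 := (toUI (M (G z) : UnitAddCircle)).2
      have h2 := (toUI (M' z : UnitAddCircle)).2
      constructor <;> linarith [h1.1, h1.2, h2.1, h2.2])
    (by
      filter_upwards [hpt] with z hz hzA
      rw [hz]
      exact abs_sub_le_of_cell_eq (not_not.1 hzA))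
  have h3 : (2 + 3 * ((n + 1 : ℕ) : ℝ)) * δ = (ε / 2) ^ 2 := by
    simp only [δ]; field_simp
  rw [h3] at hGm
  have h4 : (1 / ((n + 1 : ℕ) : ℝ)) ^ 2 ≤ (ε / 2) ^ 2 := by
    refine pow_le_pow_left₀ (by positivity) ?_ 2
    push_cast
    exact hn.le
  refine abs_le_of_sq_le_sq' ?_ hε.le |>.2
  nlinarith

/-- Functions of the class `C_Group` only depend on the law on the circle. -/
theorem IsCGroup.eq_of_circleLaw_eq {U : L2I → ℝ} (hU : IsCGroup U) {M M' : L2I}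
    (h : circleLaw M = circleLaw M') : U M = U M' := by
  -- Equal laws need not be related by an exact rearrangement, but the orbit of `M` comes
  -- arbitrarily close to `M'`, and continuity of `U` does the rest.
  have hcl : M' ∈ closure {N | U N = U M} := by
    rw [Metric.mem_closure_iff]
    intro ε hε
    obtain ⟨n, δ, hδ, hn⟩ := exists_rearr_near (half_pos hε)
    obtain ⟨N, hN, hNε⟩ := hn M M' fun k => by
      simp only [arcMass, h, sub_self, abs_zero]; exact hδ.le
    refine ⟨N, hN.2 U hU, ?_⟩
    rw [dist_comm, dist_eq_norm]
    linarith
  have hc : IsClosed {N | U N = U M} := isClosed_eq hU.continuous continuous_const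
  exact (hc.closure_eq ▸ hcl : M' ∈ {N | U N = U M}).symm

/-- Sequential compactness of the quotient space `𝐒`, in terms of representatives. -/
theorem exists_tendsto_representatives (M : ℕ → L2I) : ∃ φ : ℕ → ℕ, StrictMono φ ∧
    ∃ (N : ℕ → L2I) (N₀ : L2I), (∀ i, circleLaw (N i) = circleLaw (M (φ i))) ∧
      Filter.Tendsto N Filter.atTop (nhds N₀) := by
  -- The arc masses at all scales lie in a product of unit intervals, compact by Tychonoff.
  let P : ℕ → (∀ n : ℕ, Fin (n + 1) → ℝ) := fun i n k => arcMass (n + 1) (M i) k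
  have hK : IsCompact (Set.univ.pi fun n : ℕ => Set.univ.pi fun _ : Fin (n + 1) =>
      Set.Icc (0 : ℝ) 1) :=
    isCompact_univ_pi fun n => isCompact_univ_pi fun _ => isCompact_Icc
  obtain ⟨p, -, ψ, hψ, hp⟩ := hK.tendsto_subseq (x := P)
    fun i n _ k _ => arcMass_mem _ _
  -- Any representative of a late law can be followed by one of any later law at distance at most
  -- 2⁻ʲ. Choosing recursively gives a Cauchy sequence in L².
  have step : ∀ j : ℕ, ∀ᶠ i in Filter.atTop, ∀ i' ≥ i, ∀ M₁ : L2I,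
      circleLaw M₁ = circleLaw (M (ψ i)) →
      ∃ N : L2I, circleLaw N = circleLaw (M (ψ i')) ∧ ‖N - M₁‖ ≤ (1 / 2 : ℝ) ^ j := by
    intro j
    obtain ⟨n, δ, hδ, hn⟩ := exists_rearr_near (ε := (1 / 2 : ℝ) ^ j) (by positivity)
    have hconv := tendsto_pi_nhds.1 hp n
    obtain ⟨i₀, hi₀⟩ := Metric.cauchySeq_iff.1 hconv.cauchySeq δ hδ
    filter_upwards [Filter.eventually_ge_atTop i₀] with i hi i' hi' M₁ hM₁
    obtain ⟨N, hN, hNε⟩ := hn (M (ψ i')) M₁ fun k => by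
      have h1 := (dist_le_pi_dist _ _ k).trans (hi₀ i' (hi.trans hi') i hi).le
      rw [Real.dist_eq] at h1
      simp only [arcMass, hM₁]
      exact h1
    exact ⟨N, hN.1, hNε⟩
  obtain ⟨χ, hχ, hstep⟩ := Filter.extraction_forall_of_eventually step
  have hstep' : ∀ j, ∀ M₁ : {N : L2I // circleLaw N = circleLaw (M (ψ (χ j)))},
      ∃ N : {N : L2I // circleLaw N = circleLaw (M (ψ (χ (j + 1))))},
        ‖(N : L2I) - M₁‖ ≤ (1 / 2 : ℝ) ^ j := by
    intro j M₁
    obtain ⟨N, h1, h2⟩ := hstep j (χ (j + 1)) (hχ.monotone (Nat.le_succ j)) M₁ M₁.2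
    exact ⟨⟨N, h1⟩, h2⟩
  choose next hnext using hstep'
  let N : ∀ j, {N : L2I // circleLaw N = circleLaw (M (ψ (χ j)))} :=
    fun j => Nat.rec (motive := fun j => {N : L2I // circleLaw N = circleLaw (M (ψ (χ j)))})
      ⟨M (ψ (χ 0)), rfl⟩ (fun j M₁ => next j M₁) j
  have hc : CauchySeq fun j => (N j : L2I) := by
    refine cauchySeq_of_le_geometric (1 / 2) 1 (by norm_num) fun j => ?_
    rw [dist_comm, dist_eq_norm, one_mul]
    exact hnext j (N j)
  obtain ⟨N₀, hN₀⟩ := cauchySeq_tendsto_of_complete hc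
  exact ⟨ψ ∘ χ, hψ.comp hχ, fun j => (N j : L2I), N₀, fun j => (N j).2, hN₀⟩

/-- Otherwise representatives with values tending to -∞ could be chosen convergent, against
continuity of `U` at the limit. -/
theorem IsCGroup.bddBelow {U : L2I → ℝ} (hU : IsCGroup U) : ∃ b : ℝ, ∀ M, b ≤ U M := by
  by_contra! h
  choose M hM using fun n : ℕ => h (-n)
  obtain ⟨φ, hφ, N, N₀, hN, hlim⟩ := exists_tendsto_representatives M
  have h1 := (hU.continuous.tendsto N₀).comp hlim
  have h2 : Filter.Tendsto (U ∘ N) Filter.atTop Filter.atBot := by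
    have h3 : Filter.Tendsto (fun i : ℕ => -(i : ℝ)) Filter.atTop Filter.atBot :=
      Filter.tendsto_neg_atTop_atBot.comp tendsto_natCast_atTop_atTop
    refine Filter.tendsto_atBot_mono (fun i => ?_) h3
    simp only [Function.comp]
    rw [hU.eq_of_circleLaw_eq (hN i)]
    refine (hM (φ i)).le.trans (neg_le_neg ?_)
    exact_mod_cast hφ.id_le i
  exact not_tendsto_nhds_of_tendsto_atBot h2 _ h1

/-- Dini's theorem for functions of the class `C_Group`. -/
theorem exists_uniform_of_monotone {V : ℕ → L2I → ℝ} {U : L2I → ℝ} (hV : ∀ k, IsCGroup (V k))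
    (hU : IsCGroup U) (hmono : ∀ M, Monotone fun k => V k M)
    (hlim : ∀ M, Filter.Tendsto (fun k => V k M) Filter.atTop (nhds (U M))) {ε : ℝ} (hε : 0 < ε) :
    ∃ k, ∀ M, U M ≤ V k M + ε := by
  by_contra! h
  choose M hM using h
  obtain ⟨φ, hφ, N, N₀, hN, hNlim⟩ := exists_tendsto_representatives M
  -- Freeze the index j: by monotonicity the gap ε at `M (φ i)` persists for `V j` once i ≥ j, and
  -- it passes to the limit in i.
  have hj : ∀ j, V j N₀ + ε ≤ U N₀ := by
    intro j
    refine le_of_tendsto_of_tendsto ((((hV j).continuous.tendsto N₀).comp hNlim).add_const ε)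
      ((hU.continuous.tendsto N₀).comp hNlim) ?_
    filter_upwards [Filter.eventually_ge_atTop j] with i hi
    simp only [Function.comp]
    rw [hU.eq_of_circleLaw_eq (hN i), (hV j).eq_of_circleLaw_eq (hN i)]
    have := hmono (M (φ i)) (hi.trans (hφ.id_le i))
    dsimp only [id] at this
    linarith [hM (φ i)]
  have := le_of_tendsto' ((hlim N₀).add_const ε) hj
  linarith

/-! ### Passing to the quotient -/

theorem IsCGroup.descendsLipschitz {U : L2I → ℝ} (hU : IsCGroup U) {L : ℝ} (hL : 0 < L)
    (hlip : ∀ M M', U M' ≤ U M + L * ‖M' - M‖) : DescendsLipschitz L U := by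
  let u : SpaceS → ℝ := Quotient.lift U fun M M' h => hU.eq_of_circleLaw_eq h
  have hu : ∀ M, u (toS M) = U M := fun M => rfl
  refine ⟨u, hu, fun p q => ?_⟩
  rw [mul_comm, ← div_le_iff₀ hL]
  refine le_csInf ?_ ?_
  · obtain ⟨M, rfl⟩ := Quotient.exists_rep p
    obtain ⟨M', rfl⟩ := Quotient.exists_rep q
    exact ⟨_, M, M', rfl, rfl, rfl⟩
  · rintro r ⟨M, M', rfl, rfl, rfl⟩
    rw [div_le_iff₀ hL, hu, hu, abs_le]
    have h1 := hlip M M'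
    have h2 := hlip M' M
    rw [norm_sub_rev M' M] at h1
    constructor <;> linarith

end VlasovLO

namespace VlasovLO

/-! ### Regularity of the potentials -/

theorem exists_bound_of_doubly_periodic {E : Type*} [NormedAddCommGroup E] (f : ℝ × ℝ → E)
    (hf : Continuous f) (h1 : ∀ p, f (p + (1, 0)) = f p) (h2 : ∀ p, f (p + (0, 1)) = f p) :
    ∃ C : ℝ, 0 ≤ C ∧ ∀ p, ‖f p‖ ≤ C := by
  obtain ⟨C, hC⟩ := (isCompact_Icc (a := (0 : ℝ)) (b := 1)).prod
    (isCompact_Icc (a := (0 : ℝ)) (b := 1)) |>.exists_bound_of_continuousOn hf.continuousOn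
  have p1 : ∀ x, Function.Periodic (fun t => f (t, x)) 1 := fun x t => by
    simpa using h1 (t, x)
  have p2 : ∀ t, Function.Periodic (fun x => f (t, x)) 1 := fun t x => by
    simpa using h2 (t, x)
  have hb : ∀ p, ‖f p‖ ≤ C := by
    rintro ⟨t, x⟩
    obtain ⟨t', ht', ht⟩ := (p1 x).exists_mem_Ico₀ one_pos t
    obtain ⟨x', hx', hx⟩ := (p2 t').exists_mem_Ico₀ one_pos x
    rw [ht, hx]
    exact hC _ ⟨Set.Ico_subset_Icc_self ht', Set.Ico_subset_Icc_self hx'⟩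
  exact ⟨C, (norm_nonneg _).trans (hb 0), hb⟩

theorem exists_bound_lipschitz_of_doubly_periodic (V : ℝ → ℝ → ℝ)
    (hV : ContDiff ℝ 2 (fun p : ℝ × ℝ => V p.1 p.2))
    (hVt : ∀ t x : ℝ, V (t + 1) x = V t x) (hVx : ∀ t x : ℝ, V t (x + 1) = V t x) :
    ∃ B K : ℝ, 0 ≤ B ∧ 0 ≤ K ∧ (∀ t x, |V t x| ≤ B) ∧
      ∀ t s x y, |V t x - V s y| ≤ K * (|t - s| + |x - y|) := by
  let f : ℝ × ℝ → ℝ := fun p => V p.1 p.2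
  have h1 : ∀ p, f (p + (1, 0)) = f p := fun p => by simp [f, hVt]
  have h2 : ∀ p, f (p + (0, 1)) = f p := fun p => by simp [f, hVx]
  obtain ⟨B, hB, hfB⟩ := exists_bound_of_doubly_periodic f hV.continuous h1 h2
  obtain ⟨K, hK, hfK⟩ := exists_bound_of_doubly_periodic (fderiv ℝ f)
    (hV.continuous_fderiv (by norm_num))
    (fun p => by rw [← fderiv_comp_add_right]; congr 1; exact funext h1)
    (fun p => by rw [← fderiv_comp_add_right]; congr 1; exact funext h2)
  refine ⟨B, K, hB, hK, fun t x => hfB (t, x), fun t s x y => ?_⟩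
  have h := Convex.norm_image_sub_le_of_norm_fderiv_le (𝕜 := ℝ) (f := f) (s := Set.univ)
    (fun p _ => (hV.differentiable (by norm_num)) p) (fun p _ => hfK p) convex_univ
    (Set.mem_univ (s, y)) (Set.mem_univ (t, x))
  refine h.trans (mul_le_mul_of_nonneg_left ?_ hK)
  simp only [Prod.mk_sub_mk, Prod.norm_mk, Real.norm_eq_abs]
  exact max_le (le_add_of_nonneg_right (abs_nonneg _)) (le_add_of_nonneg_left (abs_nonneg _))

/-- Periodic potentials with a common bound `B` and a common Lipschitz constant `K`. -/
structure RegularPotentials (V : ℝ → ℝ → ℝ) (W : ℝ → ℝ) (B K : ℝ) : Prop where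
  B_nonneg : 0 ≤ B
  K_nonneg : 0 ≤ K
  V_periodic : ∀ t, Function.Periodic (V t) 1
  W_periodic : Function.Periodic W 1
  V_le : ∀ t x, |V t x| ≤ B
  W_le : ∀ x, |W x| ≤ B
  V_lip : ∀ t s x y, |V t x - V s y| ≤ K * (|t - s| + |x - y|)
  W_lip : ∀ x y, |W x - W y| ≤ K * |x - y|

theorem exists_regularPotentials (V : ℝ → ℝ → ℝ) (W : ℝ → ℝ)
    (hV : ContDiff ℝ 2 (fun p : ℝ × ℝ => V p.1 p.2))
    (hVt : ∀ t x : ℝ, V (t + 1) x = V t x) (hVx : ∀ t x : ℝ, V t (x + 1) = V t x)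
    (hW : ContDiff ℝ 2 W) (hWper : ∀ x : ℝ, W (x + 1) = W x) :
    ∃ B K : ℝ, RegularPotentials V W B K := by
  obtain ⟨B₁, K₁, hB₁, hK₁, hb₁, hl₁⟩ := exists_bound_lipschitz_of_doubly_periodic V hV hVt hVx
  obtain ⟨B₂, K₂, hB₂, hK₂, hb₂, hl₂⟩ := exists_bound_lipschitz_of_doubly_periodic
    (fun _ x => W x) (hW.comp contDiff_snd) (fun _ _ => rfl) (fun _ x => hWper x)
  refine ⟨max B₁ B₂, max K₁ K₂, le_max_of_le_left hB₁, le_max_of_le_left hK₁, hVx, hWper,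
    fun t x => (hb₁ t x).trans (le_max_left _ _), fun x => (hb₂ 0 x).trans (le_max_right _ _),
    fun t s x y => (hl₁ t s x y).trans
      (mul_le_mul_of_nonneg_right (le_max_left _ _) (by positivity)),
    fun x y => ?_⟩
  have := (hl₂ 0 0 x y).trans (mul_le_mul_of_nonneg_right (le_max_right K₁ K₂) (by positivity))
  simpa using this

/-! ### Elementary facts on `L²(I)` -/

theorem integrable_coeFn (N : L2I) : Integrable N nu0 := (Lp.memLp N).integrable (by norm_num)

/-- The constant function `1`. -/
noncomputable def oneLp : L2I := Lp.const 2 nu0 (1 : ℝ)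

theorem coeFn_oneLp : oneLp =ᵐ[nu0] fun _ => (1 : ℝ) := Lp.coeFn_const ..

theorem inner_oneLp (N : L2I) : inner ℝ oneLp N = ∫ z, N z ∂nu0 := by
  rw [L2.inner_def]
  refine integral_congr_ae ?_
  filter_upwards [coeFn_oneLp] with z hz
  simp [hz]

theorem norm_oneLp_le : ‖oneLp‖ ≤ 1 := by
  refine norm_le_of_ae_le zero_le_one ?_
  filter_upwards [coeFn_oneLp] with z hz
  simp [hz]

theorem abs_integral_le_norm (N : L2I) : |∫ z, N z ∂nu0| ≤ ‖N‖ := by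
  rw [← inner_oneLp]
  refine (abs_real_inner_le_norm _ _).trans ?_
  exact mul_le_of_le_one_left (norm_nonneg _) norm_oneLp_le

theorem coeFn_abs (N : L2I) : (|N| : L2I) =ᵐ[nu0] fun z => |N z| := Lp.coeFn_abs N

theorem integral_abs_le_norm (N : L2I) : ∫ z, |N z| ∂nu0 ≤ ‖N‖ := by
  rw [← integral_congr_ae (coeFn_abs N), ← norm_abs_eq_norm N]
  exact (le_abs_self _).trans (abs_integral_le_norm _)

theorem integral_abs_sub_le_norm (M M' : L2I) : ∫ z, |M z - M' z| ∂nu0 ≤ ‖M - M'‖ := by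
  refine le_trans (le_of_eq (integral_congr_ae ?_)) (integral_abs_le_norm (M - M'))
  filter_upwards [Lp.coeFn_sub M M'] with z hz
  rw [hz, Pi.sub_apply]

/-- Subtract the nearest integer pointwise. -/
theorem exists_intValued_add_norm_le (D : L2I) :
    ∃ Z : L2I, IntValued Z ∧ ‖D + Z‖ ≤ ‖D‖ ∧ ‖D + Z‖ ≤ 1 := by
  have hm : Measurable fun x : ℝ => x - round x := by
    simp only [round_eq]
    exact measurable_id.sub (measurable_from_top.comp
      (Int.measurable_floor.comp (measurable_id.add_const _)))
  have hb : ∀ x : ℝ, |x - round x| ≤ 1 := fun x => (abs_sub_round x).trans (by norm_num)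
  have hL : MemLp (fun z => D z - round (D z)) 2 nu0 :=
    MemLp.of_bound (hm.comp (Lp.stronglyMeasurable D).measurable).aestronglyMeasurable 1
      (Filter.Eventually.of_forall fun z => hb _)
  set R : L2I := hL.toLp _
  have hR : R =ᵐ[nu0] fun z => D z - round (D z) := hL.coeFn_toLp
  refine ⟨R - D, ?_, ?_, ?_⟩
  · filter_upwards [hR, Lp.coeFn_sub R D] with z h1 h2
    exact ⟨-round (D z), by rw [h2, Pi.sub_apply, h1]; push_cast; ring⟩
  · rw [add_sub_cancel]
    refine Lp.norm_le_norm_of_ae_le ?_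
    filter_upwards [hR] with z h1
    rw [h1, Real.norm_eq_abs, Real.norm_eq_abs]
    simpa using round_le (D z) 0
  · rw [add_sub_cancel]
    refine norm_le_of_ae_le zero_le_one ?_
    filter_upwards [hR] with z h1
    rw [h1]; exact hb _

/-! ### The potentials on `L²(I)` -/

theorem abs_integral_le_of_abs_le {f : UI → ℝ} {C : ℝ} (h : ∀ z, |f z| ≤ C) :
    |∫ z, f z ∂nu0| ≤ C := by
  have := norm_integral_le_of_norm_le_const (μ := nu0) (f := f) (C := C)
    (Filter.Eventually.of_forall h)
  simpa using this

theorem abs_integral_sub_le {f g : UI → ℝ} {K e : ℝ} (M M' : L2I) (hf : Integrable f nu0)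
    (hg : Integrable g nu0) (hK : 0 ≤ K) (h : ∀ z, |f z - g z| ≤ K * (e + |M z - M' z|)) :
    |∫ z, f z ∂nu0 - ∫ z, g z ∂nu0| ≤ K * (e + ‖M - M'‖) := by
  have hi : Integrable (fun z => |M z - M' z|) nu0 :=
    ((integrable_coeFn M).sub (integrable_coeFn M')).abs
  rw [← integral_sub hf hg]
  refine (abs_integral_le_integral_abs).trans ?_
  refine (integral_mono (hf.sub hg).abs (((integrable_const e).add hi).const_mul K) h).trans ?_
  rw [integral_const_mul, integral_add' (integrable_const e) hi]
  have := integral_abs_sub_le_norm M M'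
  refine mul_le_mul_of_nonneg_left ?_ hK
  simpa using this

namespace RegularPotentials

variable {V : ℝ → ℝ → ℝ} {W : ℝ → ℝ} {B K : ℝ} (h : RegularPotentials V W B K)
include h

theorem continuous_V (t : ℝ) : Continuous (V t) := by
  refine (LipschitzWith.of_dist_le_mul (K := ⟨K, h.K_nonneg⟩) fun x y => ?_).continuous
  change |V t x - V t y| ≤ K * |x - y|
  simpa using h.V_lip t t x y

theorem continuous_W : Continuous W :=
  (LipschitzWith.of_dist_le_mul (K := ⟨K, h.K_nonneg⟩) fun x y => h.W_lip x y).continuous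

theorem integrable_V (t : ℝ) (M : L2I) : Integrable (fun z => V t (M z)) nu0 :=
  Integrable.of_bound ((h.continuous_V t).measurable.comp
    (Lp.stronglyMeasurable M).measurable).aestronglyMeasurable B
    (Filter.Eventually.of_forall fun _ => h.V_le _ _)

theorem integrable_W (x : ℝ) (M : L2I) : Integrable (fun z => W (x - M z)) nu0 :=
  Integrable.of_bound (h.continuous_W.measurable.comp
    (measurable_const.sub (Lp.stronglyMeasurable M).measurable)).aestronglyMeasurable B
    (Filter.Eventually.of_forall fun _ => h.W_le _)

theorem abs_convW_sub_le (x y : ℝ) (M M' : L2I) :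
    |∫ z, W (x - M z) ∂nu0 - ∫ z, W (y - M' z) ∂nu0| ≤ K * (|x - y| + ‖M - M'‖) := by
  refine abs_integral_sub_le M M' (h.integrable_W x M) (h.integrable_W y M') h.K_nonneg fun z => ?_
  refine (h.W_lip _ _).trans (mul_le_mul_of_nonneg_left ?_ h.K_nonneg)
  have := abs_sub (x - y) (M z - M' z)
  rwa [show x - M z - (y - M' z) = x - y - (M z - M' z) by ring]

theorem integrable_convW (M : L2I) : Integrable (fun z => ∫ z', W (M z - M z') ∂nu0) nu0 := by
  have hc : Continuous fun x => ∫ z', W (x - M z') ∂nu0 := by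
    refine (LipschitzWith.of_dist_le_mul (K := ⟨K, h.K_nonneg⟩) fun x y => ?_).continuous
    change |_ - _| ≤ K * |x - y|
    simpa using h.abs_convW_sub_le x y M M
  exact Integrable.of_bound (hc.measurable.comp
    (Lp.stronglyMeasurable M).measurable).aestronglyMeasurable B
    (Filter.Eventually.of_forall fun z => abs_integral_le_of_abs_le fun z' => h.W_le _)

theorem abs_potV_le (t : ℝ) (M : L2I) : |potV V t M| ≤ B :=
  abs_integral_le_of_abs_le fun _ => h.V_le _ _

theorem abs_potW_le (M : L2I) : |potW W M| ≤ B := by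
  have h1 : |∫ z, ∫ z', W (M z - M z') ∂nu0 ∂nu0| ≤ B :=
    abs_integral_le_of_abs_le fun _ => abs_integral_le_of_abs_le fun _ => h.W_le _
  rw [potW, abs_mul, abs_of_pos (by norm_num : (0 : ℝ) < 1 / 2)]
  linarith [h.B_nonneg]

theorem abs_potV_sub_le (t s : ℝ) (M M' : L2I) :
    |potV V t M - potV V s M'| ≤ K * (|t - s| + ‖M - M'‖) :=
  abs_integral_sub_le M M' (h.integrable_V t M) (h.integrable_V s M') h.K_nonneg
    fun _ => h.V_lip _ _ _ _

theorem abs_potW_sub_le (M M' : L2I) : |potW W M - potW W M'| ≤ K * ‖M - M'‖ := by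
  -- Both arguments of `W` vary, which doubles the bound; the factor 1/2 in `potW` compensates.
  have := abs_integral_sub_le (e := ‖M - M'‖) M M' (h.integrable_convW M) (h.integrable_convW M')
    h.K_nonneg fun z => by
      rw [add_comm]
      exact h.abs_convW_sub_le (M z) (M' z) M M'
  rw [potW, potW, ← mul_sub, abs_mul, abs_of_pos (by norm_num : (0 : ℝ) < 1 / 2)]
  linarith

theorem potV_add_intValued (t : ℝ) (M Z : L2I) (hZ : IntValued Z) :
    potV V t (M + Z) = potV V t M := by
  refine integral_congr_ae ?_
  filter_upwards [hZ, Lp.coeFn_add M Z] with z ⟨k, hk⟩ hadd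
  rw [hadd, Pi.add_apply, hk]
  simpa using (h.V_periodic t).int_mul k (M z)

theorem potW_add_intValued (M Z : L2I) (hZ : IntValued Z) : potW W (M + Z) = potW W M := by
  have hae : ∀ᵐ z ∂nu0, ∃ k : ℤ, (M + Z : L2I) z = M z + k := by
    filter_upwards [hZ, Lp.coeFn_add M Z] with z ⟨k, hk⟩ hadd
    exact ⟨k, by rw [hadd, Pi.add_apply, hk]⟩
  rw [potW, potW]
  congr 1
  refine integral_congr_ae ?_
  filter_upwards [hae] with z ⟨k, hk⟩
  refine integral_congr_ae ?_
  filter_upwards [hae] with z' ⟨k', hk'⟩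
  rw [hk, hk']
  have := h.W_periodic.int_mul (k - k') (M z - M z')
  rw [← this]
  congr 1
  push_cast
  ring

end RegularPotentials

theorem potV_comp (V : ℝ → ℝ → ℝ) (t : ℝ) (M : L2I) (G : UI ≃ᵐ UI)
    (hG : MeasurePreserving G nu0 nu0) :
    potV V t (Lp.compMeasurePreserving G hG M) = potV V t M := by
  rw [potV, potV, ← hG.integral_comp' (fun z => V t (M z))]
  refine integral_congr_ae ?_
  filter_upwards [Lp.coeFn_compMeasurePreserving M hG] with z hz
  rw [hz]; rfl

theorem potW_comp (W : ℝ → ℝ) (M : L2I) (G : UI ≃ᵐ UI) (hG : MeasurePreserving G nu0 nu0) :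
    potW W (Lp.compMeasurePreserving G hG M) = potW W M := by
  rw [potW, potW, ← hG.integral_comp' (fun z => ∫ z', W (M z - M z') ∂nu0)]
  congr 1
  refine integral_congr_ae ?_
  filter_upwards [Lp.coeFn_compMeasurePreserving M hG] with z hz
  rw [← hG.integral_comp' (fun z' => W (M (G z) - M z'))]
  refine integral_congr_ae ?_
  filter_upwards [Lp.coeFn_compMeasurePreserving M hG] with z' hz'
  rw [hz, hz']; rfl

theorem integral_comp_rearr (N : L2I) (G : UI ≃ᵐ UI) (hG : MeasurePreserving G nu0 nu0) :
    ∫ z, Lp.compMeasurePreserving G hG N z ∂nu0 = ∫ z, N z ∂nu0 := by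
  rw [← hG.integral_comp' N]
  refine integral_congr_ae ?_
  filter_upwards [Lp.coeFn_compMeasurePreserving N hG] with z hz
  rw [hz]; rfl

theorem lagr_comp (V : ℝ → ℝ → ℝ) (W : ℝ → ℝ) (c t : ℝ) (M N : L2I) (G : UI ≃ᵐ UI)
    (hG : MeasurePreserving G nu0 nu0) :
    lagr V W c t (Lp.compMeasurePreserving G hG M) (Lp.compMeasurePreserving G hG N)
      = lagr V W c t M N := by
  rw [lagr, potV_comp, potW_comp, integral_comp_rearr, Lp.norm_compMeasurePreserving, lagr]

/-! ### Absolutely continuous curves -/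

namespace IsACWithDeriv

variable {σ v σ₁ v₁ : ℝ → L2I}

theorem intervalIntegrable_smul_left (h : IsACWithDeriv σ v) {φ : ℝ → ℝ} (hφ : Continuous φ) :
    IntervalIntegrable (fun t => φ t • σ t) volume 0 1 := by
  refine ContinuousOn.intervalIntegrable ?_
  rw [Set.uIcc_of_le zero_le_one]
  exact hφ.continuousOn.smul h.continuousOn

theorem intervalIntegrable_smul_right (h : IsACWithDeriv σ v) {φ : ℝ → ℝ} (hφ : Continuous φ) :
    IntervalIntegrable (fun t => φ t • v t) volume 0 1 :=
  h.integrable.continuousOn_smul hφ.continuousOn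

theorem add (h : IsACWithDeriv σ v) (h₁ : IsACWithDeriv σ₁ v₁) :
    IsACWithDeriv (fun t => σ t + σ₁ t) (fun t => v t + v₁ t) where
  continuousOn := h.continuousOn.add h₁.continuousOn
  integrable := h.integrable.add h₁.integrable
  weakDeriv φ hφ hc hs := by
    simp only [smul_add]
    rw [intervalIntegral.integral_add (h.intervalIntegrable_smul_left hφ.continuous_deriv_one)
      (h₁.intervalIntegrable_smul_left hφ.continuous_deriv_one),
      intervalIntegral.integral_add (h.intervalIntegrable_smul_right hφ.continuous)
      (h₁.intervalIntegrable_smul_right hφ.continuous), h.weakDeriv φ hφ hc hs,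
      h₁.weakDeriv φ hφ hc hs, neg_add]

theorem clm_comp (h : IsACWithDeriv σ v) (T : L2I →L[ℝ] L2I) :
    IsACWithDeriv (fun t => T (σ t)) (fun t => T (v t)) where
  continuousOn := T.continuous.comp_continuousOn h.continuousOn
  integrable := ⟨T.integrable_comp h.integrable.1, T.integrable_comp h.integrable.2⟩
  weakDeriv φ hφ hc hs := by
    simp only [← map_smul]
    rw [T.intervalIntegral_comp_comm (h.intervalIntegrable_smul_left hφ.continuous_deriv_one),
      T.intervalIntegral_comp_comm (h.intervalIntegrable_smul_right hφ.continuous),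
      h.weakDeriv φ hφ hc hs, map_neg]

theorem line (A D : L2I) : IsACWithDeriv (fun t => A + t • D) (fun _ => D) where
  continuousOn := by fun_prop
  integrable := intervalIntegrable_const
  weakDeriv φ hφ _ hs := by
    have e : ∀ t, φ t ≠ 0 → t ∈ Set.Ioo (0 : ℝ) 1 := fun t ht => hs (subset_tsupport _ ht)
    have e0 : φ 0 = 0 := by by_contra h0; exact (lt_irrefl _ (e 0 h0).1)
    have e1 : φ 1 = 0 := by by_contra h1; exact (lt_irrefl _ (e 1 h1).2)
    have hd : ∀ t : ℝ, HasDerivAt (fun t => φ t • (A + t • D))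
        (φ t • D + deriv φ t • (A + t • D)) t := by
      intro t
      have h1 : HasDerivAt φ (deriv φ t) t := (hφ.differentiable one_ne_zero t).hasDerivAt
      have h2 : HasDerivAt (fun t : ℝ => A + t • D) D t := by
        simpa using ((hasDerivAt_id t).smul_const D).const_add A
      exact h1.smul h2
    have c1 : Continuous fun t => φ t • D := hφ.continuous.smul continuous_const
    have c2 : Continuous fun t : ℝ => deriv φ t • (A + t • D) :=
      hφ.continuous_deriv_one.smul (by fun_prop)
    have := intervalIntegral.integral_eq_sub_of_hasDerivAt (fun t _ => hd t)
      ((c1.add c2).intervalIntegrable 0 1)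
    rw [intervalIntegral.integral_add (c1.intervalIntegrable 0 1) (c2.intervalIntegrable 0 1),
      e0, e1, zero_smul, zero_smul, sub_zero] at this
    exact (neg_eq_of_add_eq_zero_right this).symm

end IsACWithDeriv

end VlasovLO

namespace VlasovLO

/-! ### The Lax-Oleinik operator with real values -/

/-- `a` is the action of an absolutely continuous curve of finite action from `M` to `M₁`. -/
def IsAction (V : ℝ → ℝ → ℝ) (W : ℝ → ℝ) (c : ℝ) (M M₁ : L2I) (a : ℝ) : Prop :=
  ∃ σ v : ℝ → L2I, IsACWithDeriv σ v ∧ σ 0 = M ∧ σ 1 = M₁ ∧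
    IntervalIntegrable (fun t => lagr V W c t (σ t) (v t)) volume 0 1 ∧
    a = ∫ t in (0 : ℝ)..1, lagr V W c t (σ t) (v t)

/-- The set over which `Û(M)` is an infimum, without the infinite values. -/
def valueSet (V : ℝ → ℝ → ℝ) (W : ℝ → ℝ) (c : ℝ) (U : L2I → ℝ) (M : L2I) : Set ℝ :=
  {x | ∃ (M₁ : L2I) (a : ℝ), IsAction V W c M M₁ a ∧ x = a + U M₁}

/-- `Û(M)` as a real number. -/
noncomputable def realHat (V : ℝ → ℝ → ℝ) (W : ℝ → ℝ) (c : ℝ) (U : L2I → ℝ) (M : L2I) : ℝ :=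
  sInf (valueSet V W c U M)

/-- Curves of infinite action contribute only ⊤ and do not affect an infimum that is finite. -/
theorem hatU_eq_realHat {V : ℝ → ℝ → ℝ} {W : ℝ → ℝ} {c : ℝ} {U : L2I → ℝ} {M : L2I}
    (hne : (valueSet V W c U M).Nonempty) (hbdd : BddBelow (valueSet V W c U M)) :
    hatU V W c U M = (realHat V W c U M : EReal) := by
  have hle : ∀ x ∈ valueSet V W c U M, hatU V W c U M ≤ (x : EReal) := by
    rintro x ⟨M₁, a, ⟨σ, v, hσ, h0, h1, hi, rfl⟩, rfl⟩
    refine sInf_le ⟨σ, v, hσ, h0, ?_⟩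
    rw [action, if_pos hi, h1, EReal.coe_add]
  have hge : (realHat V W c U M : EReal) ≤ hatU V W c U M := by
    refine le_sInf ?_
    rintro x ⟨σ, v, hσ, h0, rfl⟩
    by_cases hi : IntervalIntegrable (fun t => lagr V W c t (σ t) (v t)) volume 0 1
    · rw [action, if_pos hi, ← EReal.coe_add, EReal.coe_le_coe_iff]
      exact csInf_le hbdd ⟨σ 1, _, ⟨σ, v, hσ, h0, rfl, hi, rfl⟩, rfl⟩
    · rw [action, if_neg hi, EReal.top_add_coe]
      exact le_top
  refine le_antisymm ?_ hge
  obtain ⟨x₀, hx₀⟩ := hne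
  have htop : hatU V W c U M ≠ ⊤ := ((hle x₀ hx₀).trans_lt (EReal.coe_lt_top _)).ne
  have hbot : hatU V W c U M ≠ ⊥ := ((EReal.bot_lt_coe _).trans_le hge).ne'
  lift hatU V W c U M to ℝ using ⟨htop, hbot⟩ with r
  rw [EReal.coe_le_coe_iff]
  exact le_csInf ⟨x₀, hx₀⟩ fun x hx => EReal.coe_le_coe_iff.1 (hle x hx)

/-! ### Action bounds, symmetries and the Lipschitz estimate -/

namespace RegularPotentials

variable {V : ℝ → ℝ → ℝ} {W : ℝ → ℝ} {B K : ℝ} (h : RegularPotentials V W B K) (c : ℝ)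
include h

theorem lagr_le (t : ℝ) (M N : L2I) :
    lagr V W c t M N ≤ (1 / 2) * ‖N‖ ^ 2 + |c| * ‖N‖ + 2 * B := by
  have h1 := (abs_le.1 (h.abs_potV_le t M)).1
  have h2 := (abs_le.1 (h.abs_potW_le M)).1
  have h3 : |c * ∫ z, N z ∂nu0| ≤ |c| * ‖N‖ := by
    rw [abs_mul]; exact mul_le_mul_of_nonneg_left (abs_integral_le_norm N) (abs_nonneg _)
  rw [lagr]
  linarith [(abs_le.1 h3).1]

/-- Young's inequality |c|‖N‖ ≤ c² + ‖N‖²/4 absorbs the linear term. -/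
theorem le_lagr (t : ℝ) (M N : L2I) :
    (1 / 4) * ‖N‖ ^ 2 - c ^ 2 - 2 * B ≤ lagr V W c t M N := by
  have h1 := (abs_le.1 (h.abs_potV_le t M)).2
  have h2 := (abs_le.1 (h.abs_potW_le M)).2
  have h3 : |c * ∫ z, N z ∂nu0| ≤ |c| * ‖N‖ := by
    rw [abs_mul]; exact mul_le_mul_of_nonneg_left (abs_integral_le_norm N) (abs_nonneg _)
  rw [lagr]
  nlinarith [(abs_le.1 h3).2, sq_nonneg (|c| - ‖N‖ / 2), sq_abs c]

theorem lagr_add_intValued (t : ℝ) (M Z N : L2I) (hZ : IntValued Z) :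
    lagr V W c t (M + Z) N = lagr V W c t M N := by
  rw [lagr, lagr, h.potV_add_intValued t M Z hZ, h.potW_add_intValued M Z hZ]

theorem continuousOn_potentials {σ : ℝ → L2I} (hσ : ContinuousOn σ (Set.Icc 0 1)) :
    ContinuousOn (fun t => potV V t (σ t) + potW W (σ t)) (Set.Icc 0 1) := by
  have h1 : Continuous fun p : ℝ × L2I => potV V p.1 p.2 := by
    refine (LipschitzWith.of_dist_le_mul (K := 2 * ⟨K, h.K_nonneg⟩) fun p q => ?_).continuous
    change |_ - _| ≤ 2 * K * dist p q
    refine (h.abs_potV_sub_le p.1 q.1 p.2 q.2).trans ?_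
    have e1 : |p.1 - q.1| ≤ dist p q := le_max_left _ _
    have e2 : ‖p.2 - q.2‖ ≤ dist p q := by rw [← dist_eq_norm]; exact le_max_right _ _
    nlinarith [h.K_nonneg]
  have h2 : Continuous (potW W) := by
    refine (LipschitzWith.of_dist_le_mul (K := ⟨K, h.K_nonneg⟩) fun p q => ?_).continuous
    rw [dist_eq_norm p q]
    exact h.abs_potW_sub_le p q
  exact (h1.comp_continuousOn (continuousOn_id.prodMk hσ)).add (h2.comp_continuousOn hσ)

/-- The potentials are continuous along the curve and the linear term is a bounded functional of an
integrable velocity, so only the kinetic term matters. -/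
theorem intervalIntegrable_lagr_iff {σ v : ℝ → L2I} (hσ : IsACWithDeriv σ v) :
    IntervalIntegrable (fun t => lagr V W c t (σ t) (v t)) volume 0 1 ↔
      IntervalIntegrable (fun t => ‖v t‖ ^ 2) volume 0 1 := by
  have hp : IntervalIntegrable (fun t => potV V t (σ t) + potW W (σ t)) volume 0 1 := by
    refine ContinuousOn.intervalIntegrable ?_
    rw [Set.uIcc_of_le zero_le_one]
    exact h.continuousOn_potentials hσ.continuousOn
  have hc : IntervalIntegrable (fun t => c * ∫ z, v t z ∂nu0) volume 0 1 := by
    have : IntervalIntegrable (fun t => innerSL ℝ oneLp (v t)) volume 0 1 :=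
      ⟨(innerSL ℝ oneLp).integrable_comp hσ.integrable.1,
        (innerSL ℝ oneLp).integrable_comp hσ.integrable.2⟩
    simp only [innerSL_apply_apply, inner_oneLp] at this
    exact this.const_mul c
  constructor
  · intro hl
    convert ((hl.add hp).add hc).const_mul 2 using 2
    simp only [lagr]
    ring
  · intro hv
    convert ((hv.const_mul (1 / 2)).sub hp).sub hc using 2
    simp only [lagr]
    ring

theorem isAction_add_intValued {M M₁ Z : L2I} {a : ℝ} (hZ : IntValued Z)
    (ha : IsAction V W c M M₁ a) : IsAction V W c (M + Z) (M₁ + Z) a := by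
  obtain ⟨σ, v, hσ, rfl, rfl, hi, rfl⟩ := ha
  have hσ' := hσ.add (IsACWithDeriv.line Z 0)
  simp only [smul_zero, add_zero] at hσ'
  refine ⟨_, _, hσ', rfl, rfl, ?_, ?_⟩
  · simpa only [h.lagr_add_intValued c _ _ _ _ hZ] using hi
  · simp only [h.lagr_add_intValued c _ _ _ _ hZ]

omit h in
theorem _root_.VlasovLO.IsAction.comp {M M₁ : L2I} {a : ℝ} (ha : IsAction V W c M M₁ a)
    (G : UI ≃ᵐ UI) (hG : MeasurePreserving G nu0 nu0) :
    IsAction V W c (Lp.compMeasurePreserving G hG M) (Lp.compMeasurePreserving G hG M₁) a := by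
  obtain ⟨σ, v, hσ, rfl, rfl, hi, rfl⟩ := ha
  refine ⟨_, _, hσ.clm_comp (Lp.compMeasurePreservingₗᵢ ℝ G hG).toContinuousLinearMap,
    rfl, rfl, ?_, ?_⟩
  · exact hi.congr fun t _ => (lagr_comp V W c t (σ t) (v t) G hG).symm
  · exact intervalIntegral.integral_congr fun t _ => (lagr_comp V W c t (σ t) (v t) G hG).symm

/-- The action of a segment. -/
theorem exists_isAction_segment (M M₁ : L2I) : ∃ a, IsAction V W c M M₁ a ∧
    a ≤ (1 / 2) * ‖M₁ - M‖ ^ 2 + |c| * ‖M₁ - M‖ + 2 * B := by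
  have hσ := IsACWithDeriv.line M (M₁ - M)
  have hi := (h.intervalIntegrable_lagr_iff c hσ).2 intervalIntegrable_const
  refine ⟨_, ⟨_, _, hσ, by simp, by simp, hi, rfl⟩, ?_⟩
  have := intervalIntegral.integral_mono_on zero_le_one hi intervalIntegrable_const
    fun t _ => h.lagr_le c t (M + t • (M₁ - M)) (M₁ - M)
  simpa using this

theorem le_isAction {M M₁ : L2I} {a : ℝ} (ha : IsAction V W c M M₁ a) : -c ^ 2 - 2 * B ≤ a := by
  obtain ⟨σ, v, hσ, rfl, rfl, hi, rfl⟩ := ha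
  have := intervalIntegral.integral_mono_on zero_le_one
    (intervalIntegrable_const (c := -c ^ 2 - 2 * B)) hi fun t _ => by
      have := h.le_lagr c t (σ t) (v t)
      nlinarith [sq_nonneg ‖v t‖]
  simpa using this

/-- A Lipschitz constant for the functions `Û`. -/
noncomputable def _root_.VlasovLO.lipConst (B K c : ℝ) : ℝ :=
  2 * (1 / 2 + |c| + 2 * B + 1 + c ^ 2 + 2 * B) + 1 + 2 * K + |c|

theorem lipConst_pos : 0 < lipConst B K c := by
  have := h.B_nonneg
  have := h.K_nonneg
  have := abs_nonneg c
  rw [lipConst]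
  positivity

/-- Moving the starting point of a curve of moderate action, with the endpoint kept. -/
theorem exists_isAction_move {M M₁ : L2I} {a : ℝ} (ha : IsAction V W c M M₁ a)
    (hle : a ≤ 1 / 2 + |c| + 2 * B + 1) (D : L2I) (hD : ‖D‖ ≤ 1) :
    ∃ a', IsAction V W c (M + D) M₁ a' ∧ a' ≤ a + lipConst B K c * ‖D‖ := by
  obtain ⟨σ, v, hσ, rfl, rfl, hi, rfl⟩ := ha
  have hv := (h.intervalIntegrable_lagr_iff c hσ).1 hi
  -- Adding (1 - t)D shifts the start by `D` and fixes the end.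
  have hσ' := hσ.add (IsACWithDeriv.line D (-D))
  have hinner : IntervalIntegrable (fun t => innerSL ℝ D (v t)) volume 0 1 :=
    ⟨(innerSL ℝ D).integrable_comp hσ.integrable.1, (innerSL ℝ D).integrable_comp hσ.integrable.2⟩
  have hv' : IntervalIntegrable (fun t => ‖v t + -D‖ ^ 2) volume 0 1 := by
    convert (hv.sub (hinner.const_mul 2)).add (intervalIntegrable_const (c := ‖D‖ ^ 2)) using 2
    simp only [innerSL_apply_apply]
    rw [← sub_eq_add_neg, norm_sub_sq_real, real_inner_comm]
  have hi' := (h.intervalIntegrable_lagr_iff c hσ').2 hv'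
  refine ⟨_, ⟨_, _, hσ', by simp, by simp, hi', rfl⟩, ?_⟩
  have hpt : ∀ t ∈ Set.Icc (0 : ℝ) 1,
      lagr V W c t (σ t + (D + t • -D)) (v t + -D) ≤ lagr V W c t (σ t) (v t)
        + ‖D‖ * ((1 / 2) * ‖v t‖ ^ 2 + (1 + 2 * K + |c|)) := by
    intro t ht
    have hE : ‖σ t + (D + t • -D) - σ t‖ ≤ ‖D‖ := by
      have : σ t + (D + t • -D) - σ t = (1 - t) • D := by
        rw [smul_neg, sub_smul, one_smul]; abel
      rw [this, norm_smul, Real.norm_of_nonneg (by linarith [ht.2])]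
      exact mul_le_of_le_one_left (norm_nonneg _) (by linarith [ht.1])
    have h1 := (h.abs_potV_sub_le t t (σ t + (D + t • -D)) (σ t))
    have h2 := (h.abs_potW_sub_le (σ t + (D + t • -D)) (σ t))
    rw [sub_self, abs_zero, zero_add] at h1
    have h3 := mul_le_mul_of_nonneg_left hE h.K_nonneg
    have h1' := (abs_le.1 (h1.trans h3)).1
    have h2' := (abs_le.1 (h2.trans h3)).1
    have h4 : ∫ z, (v t + -D : L2I) z ∂nu0 = (∫ z, v t z ∂nu0) - ∫ z, D z ∂nu0 := by
      rw [← inner_oneLp, ← inner_oneLp, ← inner_oneLp, ← sub_eq_add_neg, inner_sub_right]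
    have h5 : c * ∫ z, D z ∂nu0 ≤ |c| * ‖D‖ := by
      refine (le_abs_self _).trans ?_
      rw [abs_mul]
      exact mul_le_mul_of_nonneg_left (abs_integral_le_norm D) (abs_nonneg _)
    have h6 : ‖v t + -D‖ ^ 2 = ‖v t‖ ^ 2 - 2 * inner ℝ (v t) D + ‖D‖ ^ 2 := by
      rw [← sub_eq_add_neg, norm_sub_sq_real]
    have h7 := (abs_le.1 (abs_real_inner_le_norm (v t) D)).1
    have h8 : ‖v t‖ * ‖D‖ ≤ ‖D‖ * ((1 / 2) * ‖v t‖ ^ 2 + 1 / 2) := by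
      nlinarith [mul_nonneg (norm_nonneg D) (sq_nonneg (‖v t‖ - 1))]
    have h9 : ‖D‖ ^ 2 ≤ ‖D‖ := by nlinarith [norm_nonneg D]
    rw [lagr, lagr, h4, h6]
    nlinarith
  have hb : IntervalIntegrable
      (fun t => ‖D‖ * ((1 / 2) * ‖v t‖ ^ 2 + (1 + 2 * K + |c|))) volume 0 1 :=
    ((hv.const_mul _).add intervalIntegrable_const).const_mul _
  refine (intervalIntegral.integral_mono_on zero_le_one hi' (hi.add hb) hpt).trans ?_
  rw [intervalIntegral.integral_add hi hb, intervalIntegral.integral_const_mul,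
    intervalIntegral.integral_add (hv.const_mul _) intervalIntegrable_const,
    intervalIntegral.integral_const_mul]
  have hkin : (1 / 4) * (∫ t in (0 : ℝ)..1, ‖v t‖ ^ 2) - (c ^ 2 + 2 * B)
      ≤ ∫ t in (0 : ℝ)..1, lagr V W c t (σ t) (v t) := by
    have := intervalIntegral.integral_mono_on zero_le_one
      ((hv.const_mul (1 / 4)).sub (intervalIntegrable_const (c := c ^ 2 + 2 * B))) hi
      fun t _ => by
        have := h.le_lagr c t (σ t) (v t)
        linarith
    rw [intervalIntegral.integral_sub (hv.const_mul _) intervalIntegrable_const,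
      intervalIntegral.integral_const_mul] at this
    simpa using this
  -- By `hkin`, half the integral of ‖v‖² is at most 2(a + c² + 2B); inserting the assumed bound on
  -- the action a gives `lipConst`.
  have hL : (1 / 2) * (∫ t in (0 : ℝ)..1, ‖v t‖ ^ 2) + (1 + 2 * K + |c|) ≤ lipConst B K c := by
    rw [lipConst]
    linarith
  have := mul_le_mul_of_nonneg_left hL (norm_nonneg D)
  simp only [intervalIntegral.integral_const, sub_zero, one_smul]
  linarith

variable {c} {U : L2I → ℝ}

theorem valueSet_nonempty (U : L2I → ℝ) (M : L2I) :
    (valueSet V W c U M).Nonempty := by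
  obtain ⟨a, ha, -⟩ := h.exists_isAction_segment c M M
  exact ⟨_, M, a, ha, rfl⟩

theorem exists_near_realHat (M : L2I) {ε : ℝ} (hε : 0 < ε) :
    ∃ M₁ a, IsAction V W c M M₁ a ∧ a + U M₁ ≤ realHat V W c U M + ε := by
  obtain ⟨x, ⟨M₁, a, ha, rfl⟩, hx⟩ := exists_lt_of_csInf_lt (h.valueSet_nonempty U M)
    (lt_add_of_pos_right (realHat V W c U M) hε)
  exact ⟨M₁, a, ha, hx.le⟩

theorem le_realHat {M : L2I} {x : ℝ} (hx : ∀ M₁ a, IsAction V W c M M₁ a → x ≤ a + U M₁) :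
    x ≤ realHat V W c U M := by
  refine le_csInf (h.valueSet_nonempty U M) ?_
  rintro _ ⟨M₁, a, ha, rfl⟩
  exact hx M₁ a ha

variable (hU : IsCGroup U)
include hU

theorem valueSet_bddBelow (M : L2I) : BddBelow (valueSet V W c U M) := by
  obtain ⟨b, hb⟩ := hU.bddBelow
  refine ⟨-c ^ 2 - 2 * B + b, ?_⟩
  rintro x ⟨M₁, a, ha, rfl⟩
  exact add_le_add (h.le_isAction c ha) (hb M₁)

theorem hatU_eq (M : L2I) : hatU V W c U M = (realHat V W c U M : EReal) :=
  hatU_eq_realHat (h.valueSet_nonempty U M) (h.valueSet_bddBelow hU M)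

theorem realHat_le {M M₁ : L2I} {a : ℝ} (ha : IsAction V W c M M₁ a) :
    realHat V W c U M ≤ a + U M₁ :=
  csInf_le (h.valueSet_bddBelow hU M) ⟨M₁, a, ha, rfl⟩

theorem realHat_add_intValued (M Z : L2I) (hZ : IntValued Z) :
    realHat V W c U (M + Z) = realHat V W c U M := by
  refine le_antisymm (h.le_realHat fun M₁ a ha => ?_) (h.le_realHat fun M₁ a ha => ?_)
  · rw [← hU.add_intValued M₁ Z hZ]
    exact h.realHat_le hU (h.isAction_add_intValued c hZ ha)
  · rw [← hU.add_intValued M₁ (-Z) hZ.neg]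
    have := h.isAction_add_intValued c hZ.neg ha
    rw [add_neg_cancel_right] at this
    exact h.realHat_le hU this

theorem realHat_comp_le (M : L2I) (G : UI ≃ᵐ UI) (hG : MeasurePreserving G nu0 nu0) :
    realHat V W c U (Lp.compMeasurePreserving G hG M) ≤ realHat V W c U M :=
  h.le_realHat fun M₁ _ ha => by
    rw [← hU.comp_rearrangement G hG M₁]
    exact h.realHat_le hU (ha.comp c G hG)

theorem realHat_comp (M : L2I) (G : UI ≃ᵐ UI) (hG : MeasurePreserving G nu0 nu0) :
    realHat V W c U (Lp.compMeasurePreserving G hG M) = realHat V W c U M := by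
  refine le_antisymm (h.realHat_comp_le hU M G hG) ?_
  have hG' : MeasurePreserving G.symm nu0 nu0 := hG.symm
  have e : Lp.compMeasurePreserving G.symm hG' (Lp.compMeasurePreserving G hG M) = M := by
    refine Lp.ext ?_
    filter_upwards [Lp.coeFn_compMeasurePreserving (Lp.compMeasurePreserving G hG M) hG',
      hG'.quasiMeasurePreserving.ae_eq_comp (Lp.coeFn_compMeasurePreserving M hG)] with z h1 h2
    rw [h1, h2]
    simp
  have := h.realHat_comp_le (c := c) hU (Lp.compMeasurePreserving G hG M) G.symm hG'
  rwa [e] at this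

/-- A nearly optimal curve ending at `M₁` is compared with the segment to `M₁ + Z`, of length at
most 1. As `U` has the same value at both endpoints it cancels, so the action is bounded
independently of `U` and `exists_isAction_move` applies. -/
theorem realHat_le_of_norm_le_one (M D : L2I) (hD : ‖D‖ ≤ 1) :
    realHat V W c U (M + D) ≤ realHat V W c U M + lipConst B K c * ‖D‖ := by
  refine le_of_forall_pos_le_add fun ε hε => ?_
  obtain ⟨M₁, a, ha, hle⟩ := h.exists_near_realHat (c := c) (U := U) M (lt_min hε one_pos)
  obtain ⟨Z, hZ, -, hZ1⟩ := exists_intValued_add_norm_le (M₁ - M)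
  obtain ⟨b, hb, hble⟩ := h.exists_isAction_segment c M (M₁ + Z)
  have h1 := h.realHat_le hU hb
  rw [hU.add_intValued M₁ Z hZ] at h1
  rw [show M₁ + Z - M = M₁ - M + Z by abel] at hble
  have h2 := mul_le_of_le_one_right (abs_nonneg c) hZ1
  have h3 := pow_le_one₀ (n := 2) (norm_nonneg _) hZ1
  have h4 := min_le_right ε 1
  obtain ⟨a', ha', hle'⟩ := h.exists_isAction_move c ha (by linarith) D hD
  have h5 := h.realHat_le hU ha'
  linarith [min_le_left ε 1]

theorem realHat_lipschitz (M M' : L2I) :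
    realHat V W c U M' ≤ realHat V W c U M + lipConst B K c * min 1 ‖M' - M‖ := by
  obtain ⟨Z, hZ, hZ1, hZ2⟩ := exists_intValued_add_norm_le (M' - M)
  have := h.realHat_le_of_norm_le_one (c := c) hU M (M' - M + Z) hZ2
  rw [show M + (M' - M + Z) = M' + Z by abel, h.realHat_add_intValued hU M' Z hZ] at this
  refine this.trans (add_le_add_right ?_ _)
  exact mul_le_mul_of_nonneg_left (le_min hZ2 hZ1) (h.lipConst_pos c).le

end RegularPotentials

/-- A Lipschitz bound that is uniform in the class of the functions `Û`. -/
def HasLipBound (L : ℝ) (F : L2I → ℝ) : Prop := ∀ M M', F M' ≤ F M + L * min 1 ‖M' - M‖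

namespace HasLipBound

variable {L : ℝ} {F : L2I → ℝ}

theorem le_norm (hF : HasLipBound L F) (hL : 0 < L) (M M' : L2I) : F M' ≤ F M + L * ‖M' - M‖ :=
  (hF M M').trans (add_le_add_right (mul_le_mul_of_nonneg_left (min_le_right _ _) hL.le) _)

theorem le_add (hF : HasLipBound L F) (hL : 0 < L) (M M' : L2I) : F M' ≤ F M + L :=
  (hF M M').trans (add_le_add_right (mul_le_of_le_one_right hL.le (min_le_left _ _)) _)

theorem continuous (hF : HasLipBound L F) (hL : 0 < L) : Continuous F := by
  refine (LipschitzWith.of_dist_le_mul (K := ⟨L, hL.le⟩) fun M M' => ?_).continuous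
  rw [dist_eq_norm M M', Real.dist_eq, abs_le]
  change -(L * ‖M - M'‖) ≤ _ ∧ _ ≤ L * ‖M - M'‖
  have h1 := hF.le_norm hL M M'
  have h2 := hF.le_norm hL M' M
  rw [norm_sub_rev M' M] at h1
  constructor <;> linarith

end HasLipBound

theorem RegularPotentials.realHat_isCGroup {V : ℝ → ℝ → ℝ} {W : ℝ → ℝ} {B K : ℝ}
    (h : RegularPotentials V W B K) {c : ℝ} {U : L2I → ℝ} (hU : IsCGroup U) :
    IsCGroup (realHat V W c U) where
  continuous := HasLipBound.continuous (fun M M' => h.realHat_lipschitz hU M M') (h.lipConst_pos c)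
  add_intValued := h.realHat_add_intValued hU
  comp_rearrangement G hG M := h.realHat_comp hU M G hG

end VlasovLO

namespace VlasovLO

/-! ### Quasi-additive sequences -/

/-- Both a + C and -a + C are subadditive. By Fekete's lemma each has a rate that is a lower bound
of its quotients; the two rates are opposite, which bounds a from both sides. -/
theorem exists_rate_of_quasiAdditive {a : ℕ → ℝ} {C : ℝ}
    (ha : ∀ m n, |a (m + n) - a m - a n| ≤ C) : ∃ l : ℝ, ∀ n : ℕ, |a n - n * l| ≤ C := by
  have h0 : |a 0| ≤ C := by simpa using ha 0 0
  have hC : 0 ≤ C := (abs_nonneg _).trans h0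
  have hgrow : ∀ n : ℕ, |a n| ≤ C + n * (|a 1| + C) := by
    intro n
    induction n with
    | zero => simpa using h0
    | succ n ih =>
      have h1 := abs_le.1 (ha n 1)
      have h2 := abs_le.1 ih
      have h3 := abs_le.1 (le_refl |a 1|)
      push_cast
      rw [abs_le]
      constructor <;> linarith
  have hb : ∀ b : ℕ → ℝ, (∀ n, -|a n| ≤ b n) →
      BddBelow (Set.range fun n : ℕ => (b n + C) / n) := by
    intro b hba
    refine ⟨-(|a 1| + C), ?_⟩
    rintro _ ⟨n, rfl⟩
    rcases Nat.eq_zero_or_pos n with rfl | hn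
    · simp only [Nat.cast_zero, div_zero]
      linarith [abs_nonneg (a 1)]
    · have hn' : (0 : ℝ) < n := by exact_mod_cast hn
      simp only
      rw [le_div_iff₀ hn']
      linarith [hgrow n, hba n]
  have hs : Subadditive fun n => a n + C := fun m n => by linarith [(abs_le.1 (ha m n)).2]
  have hs' : Subadditive fun n => -a n + C := fun m n => by linarith [(abs_le.1 (ha m n)).1]
  have hbd := hb a fun n => (abs_le.1 le_rfl).1
  have hbd' := hb (fun n => -a n) fun n => neg_le_neg (le_abs_self _)
  have hsum : hs.lim + hs'.lim = 0 := by
    have h1 := (hs.tendsto_lim hbd).add (hs'.tendsto_lim hbd')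
    have h2 : Filter.Tendsto (fun n : ℕ => (2 * C) / (n : ℝ)) Filter.atTop (nhds 0) :=
      tendsto_const_div_atTop_nhds_zero_nat _
    refine tendsto_nhds_unique h1 (h2.congr fun n => ?_)
    rw [← add_div]
    congr 1
    ring
  refine ⟨hs.lim, fun n => ?_⟩
  rcases Nat.eq_zero_or_pos n with rfl | hn
  · simpa using h0
  · have hn' : (0 : ℝ) < n := by exact_mod_cast hn
    have h1 := hs.lim_le_div hbd hn.ne'
    have h2 := hs'.lim_le_div hbd' hn.ne'
    rw [le_div_iff₀ hn'] at h1 h2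
    have h3 : hs'.lim = -hs.lim := by linarith
    rw [h3] at h2
    rw [abs_le]
    constructor <;> linarith

/-! ### Invariant functions -/

theorem IsCGroup.add_const {U : L2I → ℝ} (hU : IsCGroup U) (r : ℝ) : IsCGroup fun M => U M + r where
  continuous := hU.continuous.add continuous_const
  add_intValued M Z hZ := by rw [hU.add_intValued M Z hZ]
  comp_rearrangement G hG M := by rw [hU.comp_rearrangement G hG M]

theorem isCGroup_zero : IsCGroup 0 where
  continuous := continuous_const
  add_intValued _ _ _ := rfl
  comp_rearrangement _ _ _ := rfl

section Families

variable {ι : Type*} [Nonempty ι] {F : ι → L2I → ℝ} {L : ℝ}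

theorem HasLipBound.ciInf (hF : ∀ i, HasLipBound L (F i))
    (hb : ∀ M, BddBelow (Set.range fun i => F i M)) : HasLipBound L fun M => ⨅ i, F i M := by
  intro M M'
  rw [← sub_le_iff_le_add]
  refine le_ciInf fun i => ?_
  rw [sub_le_iff_le_add]
  exact (ciInf_le (hb M') i).trans (hF i M M')

theorem HasLipBound.ciSup (hF : ∀ i, HasLipBound L (F i))
    (hb : ∀ M, BddAbove (Set.range fun i => F i M)) : HasLipBound L fun M => ⨆ i, F i M := by
  intro M M'
  refine ciSup_le fun i => (hF i M M').trans ?_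
  exact add_le_add_left (le_ciSup (hb M) i) _

omit [Nonempty ι] in
theorem isCGroup_ciInf (hF : ∀ i, IsCGroup (F i)) (hc : Continuous fun M => ⨅ i, F i M) :
    IsCGroup fun M => ⨅ i, F i M where
  continuous := hc
  add_intValued M Z hZ := iInf_congr fun i => (hF i).add_intValued M Z hZ
  comp_rearrangement G hG M := iInf_congr fun i => (hF i).comp_rearrangement G hG M

omit [Nonempty ι] in
theorem isCGroup_ciSup (hF : ∀ i, IsCGroup (F i)) (hc : Continuous fun M => ⨆ i, F i M) :
    IsCGroup fun M => ⨆ i, F i M where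
  continuous := hc
  add_intValued M Z hZ := iSup_congr fun i => (hF i).add_intValued M Z hZ
  comp_rearrangement G hG M := iSup_congr fun i => (hF i).comp_rearrangement G hG M

end Families

/-! ### Fixed points -/

namespace RegularPotentials

variable {V : ℝ → ℝ → ℝ} {W : ℝ → ℝ} {B K : ℝ} (h : RegularPotentials V W B K) {c : ℝ}
include h

theorem realHat_mono {U U' : L2I → ℝ} (hU : IsCGroup U) {m : ℝ}
    (hm : ∀ M, U M ≤ U' M + m) (M : L2I) : realHat V W c U M ≤ realHat V W c U' M + m := by
  rw [← sub_le_iff_le_add]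
  refine h.le_realHat fun M₁ a ha => ?_
  linarith [h.realHat_le hU ha, hm M₁]

theorem realHat_add_const {U : L2I → ℝ} (hU : IsCGroup U) (r : ℝ) (M : L2I) :
    realHat V W c (fun M => U M + r) M = realHat V W c U M + r := by
  refine le_antisymm (h.realHat_mono (hU.add_const r) (fun _ => le_rfl) M) ?_
  have := h.realHat_mono (c := c) (U' := fun M => U M + r) hU (m := -r) (fun M => by simp) M
  linarith

theorem iterate_isCGroup {U : L2I → ℝ} (hU : IsCGroup U) (n : ℕ) :
    IsCGroup ((realHat V W c)^[n] U) := by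
  induction n with
  | zero => exact hU
  | succ n ih =>
    rw [Function.iterate_succ_apply']
    exact h.realHat_isCGroup ih

theorem iterate_mono {U U' : L2I → ℝ} (hU : IsCGroup U) {m : ℝ}
    (hm : ∀ M, U M ≤ U' M + m) (n : ℕ) (M : L2I) :
    (realHat V W c)^[n] U M ≤ (realHat V W c)^[n] U' M + m := by
  induction n generalizing M with
  | zero => exact hm M
  | succ n ih =>
    rw [Function.iterate_succ_apply', Function.iterate_succ_apply']
    exact h.realHat_mono (h.iterate_isCGroup hU n) ih M

theorem iterate_zero_hasLipBound (n : ℕ) :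
    HasLipBound (lipConst B K c) ((realHat V W c)^[n] 0) := by
  cases n with
  | zero =>
    intro M M'
    simp only [Function.iterate_zero, id_eq, Pi.zero_apply, zero_add]
    have := (h.lipConst_pos c).le
    positivity
  | succ n =>
    rw [Function.iterate_succ_apply']
    exact h.realHat_lipschitz (h.iterate_isCGroup isCGroup_zero n)

/-- The iterates of the Lax-Oleinik operator grow linearly. -/
theorem exists_rate : ∃ l : ℝ, ∀ (n : ℕ) (M : L2I),
    |(realHat V W c)^[n] 0 M - n * l| ≤ 2 * lipConst B K c := by
  have hL := h.lipConst_pos c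
  set L := lipConst B K c
  have osc : ∀ n M, (realHat V W c)^[n] 0 M ≤ (realHat V W c)^[n] 0 0 + L ∧
      (realHat V W c)^[n] 0 0 ≤ (realHat V W c)^[n] 0 M + L := fun n M =>
    ⟨(h.iterate_zero_hasLipBound n).le_add hL 0 M, (h.iterate_zero_hasLipBound n).le_add hL M 0⟩
  obtain ⟨l, hl⟩ := exists_rate_of_quasiAdditive
    (a := fun n => (realHat V W c)^[n] 0 0) (C := L) fun m n => by
      have hn := h.iterate_isCGroup (c := c) isCGroup_zero n
      -- Tⁿ0 differs from the constant (Tⁿ0)(0) by at most L, and Tᵐ transports both inequalities.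
      rw [Function.iterate_add_apply]
      have h1 := h.iterate_mono (c := c) (U' := 0) hn
        (m := (realHat V W c)^[n] 0 0 + L) (fun M => by
          rw [Pi.zero_apply, zero_add]; exact (osc n M).1) m 0
      have h2 := h.iterate_mono (c := c) (U' := (realHat V W c)^[n] 0) isCGroup_zero
        (m := -(realHat V W c)^[n] 0 0 + L) (fun M => by
          rw [Pi.zero_apply]; linarith [(osc n M).2]) m 0
      rw [abs_le]
      constructor <;> linarith
  refine ⟨l, fun n M => ?_⟩
  have h1 := abs_le.1 (hl n)
  have h2 := osc n M
  rw [abs_le]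
  constructor <;> linarith

/-- The solution is the liminf of the normalised iterates `X n`, written as the supremum of the
increasing tail infima `Y k`; T maps `Y k` to `Y (k + 1) + l`. -/
theorem exists_fixed_point : ∃ (l : ℝ) (U : L2I → ℝ), IsCGroup U ∧
    ∀ M, realHat V W c U M = U M + l := by
  have hL := h.lipConst_pos c
  obtain ⟨l, hl⟩ := h.exists_rate (c := c)
  set L := lipConst B K c
  let X : ℕ → L2I → ℝ := fun n M => (realHat V W c)^[n] 0 M + -(n * l)
  have hX : ∀ n, IsCGroup (X n) := fun n =>
    (h.iterate_isCGroup isCGroup_zero n).add_const _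
  have hXb : ∀ n M, |X n M| ≤ 2 * L := fun n M => by
    simpa only [X, ← sub_eq_add_neg] using hl n M
  have hXL : ∀ n, HasLipBound L (X n) := fun n M M' => by
    have := h.iterate_zero_hasLipBound (c := c) n M M'
    simp only [X]
    linarith
  have hXT : ∀ n M, realHat V W c (X n) M = X (n + 1) M + l := fun n M => by
    rw [h.realHat_add_const (h.iterate_isCGroup isCGroup_zero n)]
    simp only [X, Function.iterate_succ_apply']
    push_cast
    ring
  let Y : ℕ → L2I → ℝ := fun k M => ⨅ n, X (k + n) M
  have hbX : ∀ k M, BddBelow (Set.range fun n => X (k + n) M) := fun k M =>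
    ⟨-(2 * L), by rintro _ ⟨n, rfl⟩; exact (abs_le.1 (hXb _ M)).1⟩
  have hYX : ∀ k n M, k ≤ n → Y k M ≤ X n M := fun k n M hkn => by
    have := ciInf_le (hbX k M) (n - k)
    rwa [Nat.add_sub_cancel' hkn] at this
  have hYL : ∀ k, HasLipBound L (Y k) := fun k =>
    HasLipBound.ciInf (fun n => hXL (k + n)) (hbX k)
  have hY : ∀ k, IsCGroup (Y k) := fun k =>
    isCGroup_ciInf (fun n => hX (k + n)) ((hYL k).continuous hL)
  have hYmono : ∀ M, Monotone fun k => Y k M := fun M k k' hkk' =>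
    le_ciInf fun n => hYX k (k' + n) M (by omega)
  have hbY : ∀ M, BddAbove (Set.range fun k => Y k M) := fun M =>
    ⟨2 * L, by
      rintro _ ⟨k, rfl⟩
      exact (hYX k k M le_rfl).trans (abs_le.1 (hXb _ M)).2⟩
  have hYT : ∀ k M, realHat V W c (Y k) M = Y (k + 1) M + l := by
    intro k M
    refine le_antisymm ?_ ?_
    · rw [← sub_le_iff_le_add]
      refine le_ciInf fun n => ?_
      have := h.realHat_mono (c := c) (U' := X (k + n)) (hY k) (m := 0)
        (fun M => by rw [add_zero]; exact hYX k _ M (by omega)) M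
      rw [hXT, show k + n + 1 = k + 1 + n by ring] at this
      linarith
    -- The two infima, over curves and over n, are exchanged here.
    · refine h.le_realHat fun M₁ a ha => ?_
      rw [← sub_le_iff_le_add']
      refine le_ciInf fun n => ?_
      have h1 := h.realHat_le (hX (k + n)) ha
      have h2 := hYX (k + 1) (k + n + 1) M (by omega)
      rw [hXT] at h1
      linarith
  let U : L2I → ℝ := fun M => ⨆ k, Y k M
  have hYU : ∀ k M, Y k M ≤ U M := fun k M => le_ciSup (hbY M) k
  have hU : IsCGroup U := isCGroup_ciSup hY ((HasLipBound.ciSup hYL hbY).continuous hL)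
  have hlim : ∀ M, Filter.Tendsto (fun k => Y k M) Filter.atTop (nhds (U M)) := fun M =>
    tendsto_atTop_ciSup (hYmono M) (hbY M)
  refine ⟨l, U, hU, fun M => le_antisymm ?_ ?_⟩
  -- T need not commute with a supremum; the uniform bound `U ≤ Y k + ε` from Dini's theorem
  -- replaces this.
  · refine le_of_forall_pos_le_add fun ε hε => ?_
    obtain ⟨k, hk⟩ := exists_uniform_of_monotone hY hU hYmono hlim hε
    have := h.realHat_mono (c := c) hU hk M
    rw [hYT] at this
    linarith [hYU (k + 1) M]
  · rw [← le_sub_iff_add_le]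
    refine ciSup_le fun k => (hYmono M (Nat.le_succ k)).trans ?_
    have := h.realHat_mono (c := c) (U' := U) (hY k) (m := 0)
      (fun M => by rw [add_zero]; exact hYU k M) M
    rw [hYT] at this
    simp only [Nat.succ_eq_add_one]
    linarith

theorem realHat_of_isFixedPoint {α : ℝ} {U : L2I → ℝ} (hU : IsCGroup U)
    (hfix : IsFixedPointLO V W c α U) (M : L2I) : realHat V W c U M + α = U M := by
  have := hfix M
  rw [laxOleinik, h.hatU_eq hU, ← EReal.coe_add, EReal.coe_eq_coe_iff] at this
  exact this

theorem isFixedPoint_hasLipBound {α : ℝ} {U : L2I → ℝ} (hU : IsCGroup U)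
    (hfix : IsFixedPointLO V W c α U) : HasLipBound (lipConst B K c) U := fun M M' => by
  rw [← h.realHat_of_isFixedPoint hU hfix M, ← h.realHat_of_isFixedPoint hU hfix M']
  linarith [h.realHat_lipschitz (c := c) hU M M']

/-- With S = sup (U - U'), finite by the Lipschitz bounds, applying T to U ≤ U' + S gives S ≤ S + α
- α'. -/
theorem const_le_of_isFixedPoint {α α' : ℝ} {U U' : L2I → ℝ} (hU : IsCGroup U)
    (hfix : IsFixedPointLO V W c α U) (hU' : IsCGroup U') (hfix' : IsFixedPointLO V W c α' U') :
    α' ≤ α := by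
  have hL := h.lipConst_pos c
  have hb : BddAbove (Set.range fun M => U M - U' M) := by
    refine ⟨U 0 - U' 0 + 2 * lipConst B K c, ?_⟩
    rintro _ ⟨M, rfl⟩
    have h1 := (h.isFixedPoint_hasLipBound hU hfix).le_add hL 0 M
    have h2 := (h.isFixedPoint_hasLipBound hU' hfix').le_add hL M 0
    simp only
    linarith
  have hle : (⨆ M, (U M - U' M)) ≤ (⨆ M, (U M - U' M)) + α - α' := by
    refine ciSup_le fun M => ?_
    have := h.realHat_mono (c := c) (U' := U') hU (m := ⨆ M, (U M - U' M))
      (fun M => by linarith [le_ciSup hb M]) M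
    linarith [h.realHat_of_isFixedPoint hU hfix M, h.realHat_of_isFixedPoint hU' hfix' M]
  linarith

end RegularPotentials

end VlasovLO

theorem proposition2p11 (V : ℝ → ℝ → ℝ) (W : ℝ → ℝ)
    (hV : ContDiff ℝ 2 (fun p : ℝ × ℝ => V p.1 p.2))
    (hVt : ∀ t x : ℝ, V (t + 1) x = V t x) (hVx : ∀ t x : ℝ, V t (x + 1) = V t x)
    (hW : ContDiff ℝ 2 W) (hWper : ∀ x : ℝ, W (x + 1) = W x)
    (hWeven : ∀ x : ℝ, W (-x) = W x) (hWnonpos : ∀ x : ℝ, W x ≤ 0)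
    (hWzero : ∀ x : ℝ, W x = 0 ↔ ∃ k : ℤ, x = (k : ℝ))
    (hWconc : ∀ k : ℤ, deriv (deriv W) (k : ℝ) < 0)
    (c : ℝ) :
    (∃! α : ℝ, ∃ U : VlasovLO.L2I → ℝ,
      VlasovLO.IsCGroup U ∧ VlasovLO.IsFixedPointLO V W c α U) ∧
    ∃ L : ℝ, 0 < L ∧
      (∀ U : VlasovLO.L2I → ℝ, VlasovLO.IsCGroup U →
        ∃ F : VlasovLO.L2I → ℝ, (∀ M : VlasovLO.L2I, VlasovLO.hatU V W c U M = ((F M : ℝ) : EReal)) ∧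
          VlasovLO.DescendsLipschitz L F) ∧
      ∀ (α : ℝ) (U : VlasovLO.L2I → ℝ), VlasovLO.IsCGroup U →
        VlasovLO.IsFixedPointLO V W c α U → VlasovLO.DescendsLipschitz L U := by
  obtain ⟨B, K, h⟩ := VlasovLO.exists_regularPotentials V W hV hVt hVx hW hWper
  have hL := h.lipConst_pos c
  refine ⟨?_, VlasovLO.lipConst B K c, hL, fun U hU => ?_, fun α U hU hfix => ?_⟩
  · obtain ⟨l, U, hU, hfix⟩ := h.exists_fixed_point (c := c)
    have hα : VlasovLO.IsFixedPointLO V W c (-l) U := fun M => by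
      rw [VlasovLO.laxOleinik, h.hatU_eq hU, hfix M, ← EReal.coe_add, add_neg_cancel_right]
    refine ⟨-l, ⟨U, hU, hα⟩, ?_⟩
    rintro α' ⟨U', hU', hfix'⟩
    exact le_antisymm (h.const_le_of_isFixedPoint hU hα hU' hfix')
      (h.const_le_of_isFixedPoint hU' hfix' hU hα)
  · refine ⟨VlasovLO.realHat V W c U, h.hatU_eq hU, ?_⟩
    refine (h.realHat_isCGroup hU).descendsLipschitz hL ?_
    exact VlasovLO.HasLipBound.le_norm (h.realHat_lipschitz hU) hL
  · exact hU.descendsLipschitz hL ((h.isFixedPoint_hasLipBound hU hfix).le_norm hL)
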